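/- Let $D<-3$ be a squarefree integer, let $\mathcal O$ be the ring of integers of the imaginary quadratic field $\mathbb Q(\sqrt D)\subset\mathbb C$, and let $n\ge 11$. Let $\Lambda$ be a free $\mathcal O$-module of rank $n+1$ with an $\mathcal O$-valued hermitian form $h$ of signature $(n,1)$; put $\Lambda_{\mathbb C}=\Lambda\otimes_{\mathcal O}\mathbb C$ and denote the extension of $h$ to $\Lambda_{\mathbb C}$ again by $h$. Let $$\mathbb CH^n=\{[\omega]\in\mathbb P(\Lambda_{\mathbb C}) : h(\omega,\omega)<0\},$$ let $U(\Lambda)$ be the group of $\mathcal O$-linear automorphisms of $\Lambda$ preserving $h$, and let $\Gamma\le U(\Lambda)$ be a subgroup of finite index. For $[\omega]\in\mathbb CH^n$ let $G=\{g\in\Gamma : g[\omega]=[\omega]\}$ and $\mathbb W=\mathbb C\omega$, and let $G$ act on the tangent space $V=\operatorname{Hom}(\mathbb W,\Lambda_{\mathbb C}/\mathbb W)$ by $f\mapsto g\circ f\circ g^{-1}$. Let $g\in G$ act non-trivially on $V$ and not as a quasi-reflection (that is, the fixed space of $g$ on $V$ has dimension neither $n$ nor $n-1$). Then the action of $g$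 on $V$ has finite order, say $l$, and for every primitive $l$-th root of unity $\zeta$ the Reid–Tai sum satisfies $$\Sigma(g)=\sum_{i=1}^{n}\frac{a_i}{l}\ \ge\ 1,$$ where $\zeta^{a_1},\dots,\zeta^{a_n}$ with $0\le a_i<l$ are the eigenvalues of $g$ on $V$, counted with multiplicity. -/

import Mathlib

open scoped TensorProduct LinearAlgebra.Projectivization ComplexConjugate
open NumberField

namespace BallQuotient

/-- The field `ℚ(√D) ⊆ ℂ` for an integer `D < 0`, generated by `√D = i √|D|`. -/
noncomputable abbrev ImagQuad (D : ℤ) : IntermediateField ℚ ℂ :=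
  IntermediateField.adjoin ℚ {Complex.I * (Real.sqrt (-(D : ℝ)) : ℂ)}

theorem conj_mem_imagQuad (D : ℤ) {z : ℂ} (hz : z ∈ ImagQuad D) : conj z ∈ ImagQuad D := by
  have h : ImagQuad D ≤ (ImagQuad D).comap (Complex.conjAe.toAlgHom.restrictScalars ℚ) := by
    rw [IntermediateField.adjoin_le_iff, Set.singleton_subset_iff]
    change conj (Complex.I * (Real.sqrt (-(D : ℝ)) : ℂ)) ∈ ImagQuad D
    rw [map_mul, Complex.conj_I, Complex.conj_ofReal, neg_mul]
    exact neg_mem (IntermediateField.mem_adjoin_simple_self ℚ _)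
  exact h hz

/-- Complex conjugation on `ℚ(√D)`. -/
noncomputable def conjField (D : ℤ) : ImagQuad D →+* ImagQuad D :=
  ((starRingEnd ℂ).comp (algebraMap (ImagQuad D) ℂ)).codRestrict (ImagQuad D)
    fun x => conj_mem_imagQuad D x.2

/-- Complex conjugation on the ring of integers `𝓞` of `ℚ(√D)`. -/
noncomputable def conjInt (D : ℤ) : 𝓞 (ImagQuad D) →+* 𝓞 (ImagQuad D) :=
  RingOfIntegers.mapRingHom (conjField D)

theorem algebraMap_conjInt (D : ℤ) (a : 𝓞 (ImagQuad D)) :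
    algebraMap (𝓞 (ImagQuad D)) ℂ (conjInt D a) = conj (algebraMap (𝓞 (ImagQuad D)) ℂ a) := rfl

section Lattice

variable {D : ℤ} {Λ : Type*} [AddCommGroup Λ] [Module (𝓞 (ImagQuad D)) Λ]

variable (D Λ) in
/-- The complexification `Λ_ℂ` of an `𝓞`-module `Λ`. -/
abbrev Complexification : Type _ := ℂ ⊗[𝓞 (ImagQuad D)] Λ

variable (D Λ) in
/-- Sesquilinear forms on `Λ` with values in `𝓞`, conjugate linear in the first variable. -/
abbrev SesqForm : Type _ :=
  Λ →ₛₗ[conjInt D] Λ →ₗ[𝓞 (ImagQuad D)] 𝓞 (ImagQuad D)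

/-- For fixed `x ∈ Λ`, the complex linear extension of `y ↦ h(x, y)` to `Λ_ℂ`. -/
noncomputable def extendRight (h : SesqForm D Λ) (x : Λ) : Complexification D Λ →ₗ[ℂ] ℂ :=
  LinearMap.liftBaseChange ℂ (Algebra.linearMap (𝓞 (ImagQuad D)) ℂ ∘ₗ h x)

theorem extendRight_tmul (h : SesqForm D Λ) (x : Λ) (b : ℂ) (y : Λ) :
    extendRight h x (b ⊗ₜ y) = b * algebraMap (𝓞 (ImagQuad D)) ℂ (h x y) := by
  simp [extendRight]

theorem extendRight_add (h : SesqForm D Λ) (x x' : Λ) :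
    extendRight h (x + x') = extendRight h x + extendRight h x' := by
  ext y
  simp [extendRight_tmul]

theorem extendRight_smul (h : SesqForm D Λ) (r : 𝓞 (ImagQuad D)) (x : Λ) :
    extendRight h (r • x) = conj (algebraMap (𝓞 (ImagQuad D)) ℂ r) • extendRight h x := by
  ext y
  simp [extendRight_tmul, algebraMap_conjInt]

/-- The biadditive map underlying `formC`. -/
noncomputable def formCAux (h : SesqForm D Λ) :
    Complexification D Λ →+ (Complexification D Λ →ₗ[ℂ] ℂ) :=
  TensorProduct.liftAddHom
    { toFun := fun a =>
        { toFun := fun x => conj a • extendRight h x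
          map_zero' := by
            have := extendRight_smul h 0 (0 : Λ)
            simp only [zero_smul, map_zero] at this
            rw [this, smul_zero]
          map_add' := fun x x' => by rw [extendRight_add, smul_add] }
      map_zero' := by ext; simp
      map_add' := fun a a' => by ext; simp [add_mul] }
    (fun r a x => by
      change conj (r • a) • extendRight h x = conj a • extendRight h (r • x)
      rw [extendRight_smul, smul_smul, Algebra.smul_def, map_mul, mul_comm])

theorem formCAux_tmul (h : SesqForm D Λ) (a : ℂ) (x : Λ) :
    formCAux h (a ⊗ₜ x) = conj a • extendRight h x := rfl

/-- The sesquilinear extension of `h` to `Λ_ℂ`: see `formC_tmul`. -/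
noncomputable def formC (h : SesqForm D Λ) :
    Complexification D Λ →ₗ⋆[ℂ] Complexification D Λ →ₗ[ℂ] ℂ where
  toFun := formCAux h
  map_add' := map_add _
  map_smul' := fun c u => by
    induction u using TensorProduct.induction_on with
    | zero => simp
    | tmul a x =>
      rw [TensorProduct.smul_tmul', formCAux_tmul, formCAux_tmul, smul_smul, smul_eq_mul, map_mul]
    | add u v hu hv => rw [smul_add, map_add, map_add, smul_add, hu, hv]

theorem formC_tmul (h : SesqForm D Λ) (a b : ℂ) (x y : Λ) :
    formC h (a ⊗ₜ x) (b ⊗ₜ y) = conj a * b * algebraMap (𝓞 (ImagQuad D)) ℂ (h x y) := by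
  change formCAux h (a ⊗ₜ x) (b ⊗ₜ y) = _
  rw [formCAux_tmul, LinearMap.smul_apply, extendRight_tmul, smul_eq_mul, mul_assoc]

/-- A sesquilinear form on a complex vector space has signature `(p, q)` if some basis is
orthogonal with `p` vectors of square `1` and `q` vectors of square `-1`. -/
def HasSignature {E : Type*} [AddCommGroup E] [Module ℂ E] (B : E →ₗ⋆[ℂ] E →ₗ[ℂ] ℂ)
    (p q : ℕ) : Prop :=
  ∃ b : Module.Basis (Fin p ⊕ Fin q) ℂ E,
    (∀ i j, i ≠ j → B (b i) (b j) = 0) ∧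
    (∀ i, B (b (Sum.inl i)) (b (Sum.inl i)) = 1) ∧
    (∀ j, B (b (Sum.inr j)) (b (Sum.inr j)) = -1)

/-- The complex hyperbolic space: the negative lines in `ℙ(Λ_ℂ)`. -/
def complexHyperbolicSpace (h : SesqForm D Λ) : Set (ℙ ℂ (Complexification D Λ)) :=
  {p | (formC h p.rep p.rep).re < 0}

theorem mk_mem_complexHyperbolicSpace (h : SesqForm D Λ) (v : Complexification D Λ) (hv : v ≠ 0) :
    Projectivization.mk ℂ v hv ∈ complexHyperbolicSpace h ↔ (formC h v v).re < 0 := by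
  obtain ⟨a, ha⟩ := Projectivization.exists_smul_eq_mk_rep ℂ v hv
  have ha0 : 0 < Complex.normSq (a : ℂ) := Complex.normSq_pos.2 a.ne_zero
  have key : formC h ((a : ℂ) • v) ((a : ℂ) • v) =
      (Complex.normSq (a : ℂ) : ℂ) * formC h v v := by
    simp only [map_smul, LinearMap.map_smulₛₗ, LinearMap.smul_apply, smul_eq_mul,
      Complex.normSq_eq_conj_mul_self]
    ring
  have ha' : (Projectivization.mk ℂ v hv).rep = (a : ℂ) • v := ha.symm
  change (formC h (Projectivization.mk ℂ v hv).rep (Projectivization.mk ℂ v hv).rep).re < 0 ↔ _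
  rw [ha', key, Complex.re_ofReal_mul]
  constructor
  · intro hlt
    by_contra hge
    exact absurd hlt (not_lt.2 (mul_nonneg ha0.le (not_lt.1 hge)))
  · exact fun hlt => mul_neg_of_pos_of_neg ha0 hlt

/-- `U(Λ)`: the `𝓞`-linear automorphisms of `Λ` that preserve the form. -/
def unitaryGroup (h : SesqForm D Λ) : Subgroup (Λ ≃ₗ[𝓞 (ImagQuad D)] Λ) where
  carrier := {g | ∀ x y, h (g x) (g y) = h x y}
  one_mem' := fun _ _ => rfl
  mul_mem' := fun {a b} ha hb x y => (ha (b x) (b y)).trans (hb x y)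
  inv_mem' := fun {a} ha x y => by
    have := ha (a⁻¹ x) (a⁻¹ y)
    rw [← LinearEquiv.mul_apply, ← LinearEquiv.mul_apply, mul_inv_cancel] at this
    exact this.symm

/-- The complex linear extension of an automorphism of `Λ` to `Λ_ℂ`. -/
noncomputable def extendAut :
    (Λ ≃ₗ[𝓞 (ImagQuad D)] Λ) →* (Complexification D Λ ≃ₗ[ℂ] Complexification D Λ) where
  toFun := fun g => g.baseChange (𝓞 (ImagQuad D)) ℂ Λ Λ
  map_one' := by
    ext u
    induction u using TensorProduct.induction_on with
    | zero => simp
    | tmul a x => simp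
    | add u v hu hv => rw [map_add, map_add, hu, hv]
  map_mul' := fun g g' => by
    ext u
    induction u using TensorProduct.induction_on with
    | zero => simp
    | tmul a x => simp
    | add u v hu hv => rw [map_add, map_add, hu, hv]

/-- The stabiliser `G = Γ_[ω]` in `Γ ≤ U(Λ)` of a point `p = [ω]` of `ℙ(Λ_ℂ)`. -/
noncomputable def pointStabilizer (h : SesqForm D Λ) (Γ : Subgroup (unitaryGroup h))
    (p : ℙ ℂ (Complexification D Λ)) : Subgroup (unitaryGroup h) :=
  Γ ⊓ (MulAction.stabilizer (Complexification D Λ ≃ₗ[ℂ] Complexification D Λ) p).comap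
    (extendAut.comp (unitaryGroup h).subtype)

/-- The action of the stabiliser on `Λ_ℂ`. -/
noncomputable def stabAct (h : SesqForm D Λ) (Γ : Subgroup (unitaryGroup h))
    (p : ℙ ℂ (Complexification D Λ)) :
    pointStabilizer h Γ p →* (Complexification D Λ ≃ₗ[ℂ] Complexification D Λ) :=
  (extendAut.comp (unitaryGroup h).subtype).comp (pointStabilizer h Γ p).subtype

/-- The tangent space `V = Hom(𝕎, Λ_ℂ / 𝕎)` at `p = [ω]`, where `𝕎 = ℂω`. -/
abbrev TangentSpaceAt (p : ℙ ℂ (Complexification D Λ)) : Type _ :=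
  p.submodule →ₗ[ℂ] (Complexification D Λ ⧸ p.submodule)

theorem stabAct_mem (h : SesqForm D Λ) (Γ : Subgroup (unitaryGroup h))
    (p : ℙ ℂ (Complexification D Λ)) (g : pointStabilizer h Γ p) :
    ∀ u ∈ p.submodule, (stabAct h Γ p g : _ →ₗ[ℂ] _) u ∈ p.submodule := by
  intro u hu
  have hg : stabAct h Γ p g • p = p := g.2.2
  induction p using Projectivization.ind with
  | h v hv =>
    rw [Projectivization.smul_mk, Projectivization.mk_eq_mk_iff] at hg
    obtain ⟨c, hc⟩ := hg
    rw [Projectivization.submodule_mk, Submodule.mem_span_singleton] at hu ⊢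
    obtain ⟨t, rfl⟩ := hu
    refine ⟨t * (c : ℂ), ?_⟩
    rw [map_smul, mul_smul]
    exact congrArg (t • ·) hc

/-- The action of `g ∈ G` on `𝕎`. -/
noncomputable def lineAct (h : SesqForm D Λ) (Γ : Subgroup (unitaryGroup h))
    (p : ℙ ℂ (Complexification D Λ)) (g : pointStabilizer h Γ p) :
    p.submodule →ₗ[ℂ] p.submodule :=
  (stabAct h Γ p g : _ →ₗ[ℂ] _).restrict (stabAct_mem h Γ p g)

/-- The action of `g ∈ G` on `Λ_ℂ / 𝕎`. -/
noncomputable def quotAct (h : SesqForm D Λ) (Γ : Subgroup (unitaryGroup h))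
    (p : ℙ ℂ (Complexification D Λ)) (g : pointStabilizer h Γ p) :
    (Complexification D Λ ⧸ p.submodule) →ₗ[ℂ] (Complexification D Λ ⧸ p.submodule) :=
  p.submodule.mapQ p.submodule
    (stabAct h Γ p g : Complexification D Λ →ₗ[ℂ] Complexification D Λ) (stabAct_mem h Γ p g)

theorem lineAct_one (h : SesqForm D Λ) (Γ : Subgroup (unitaryGroup h))
    (p : ℙ ℂ (Complexification D Λ)) : lineAct h Γ p 1 = LinearMap.id := by
  ext u
  simp [lineAct, LinearMap.restrict_apply]

theorem lineAct_mul (h : SesqForm D Λ) (Γ : Subgroup (unitaryGroup h))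
    (p : ℙ ℂ (Complexification D Λ)) (g g' : pointStabilizer h Γ p) :
    lineAct h Γ p (g * g') = lineAct h Γ p g ∘ₗ lineAct h Γ p g' := by
  ext u
  simp [lineAct, LinearMap.restrict_apply]

theorem quotAct_one (h : SesqForm D Λ) (Γ : Subgroup (unitaryGroup h))
    (p : ℙ ℂ (Complexification D Λ)) : quotAct h Γ p 1 = LinearMap.id := by
  refine LinearMap.ext fun u => ?_
  obtain ⟨u, rfl⟩ := p.submodule.mkQ_surjective u
  simp [quotAct]

theorem quotAct_mul (h : SesqForm D Λ) (Γ : Subgroup (unitaryGroup h))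
    (p : ℙ ℂ (Complexification D Λ)) (g g' : pointStabilizer h Γ p) :
    quotAct h Γ p (g * g') = quotAct h Γ p g ∘ₗ quotAct h Γ p g' := by
  refine LinearMap.ext fun u => ?_
  obtain ⟨u, rfl⟩ := p.submodule.mkQ_surjective u
  simp [quotAct]

/-- The representation of `G` on the tangent space `V = Hom(𝕎, Λ_ℂ / 𝕎)`: `g` sends `f` to
`g ∘ f ∘ g⁻¹`. -/
noncomputable def tangentRep (h : SesqForm D Λ) (Γ : Subgroup (unitaryGroup h))
    (p : ℙ ℂ (Complexification D Λ)) :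
    Representation ℂ (pointStabilizer h Γ p) (TangentSpaceAt p) where
  toFun := fun g =>
    { toFun := fun f => quotAct h Γ p g ∘ₗ f ∘ₗ lineAct h Γ p g⁻¹
      map_add' := fun f f' => by rw [LinearMap.add_comp, LinearMap.comp_add]
      map_smul' := fun c f => by
        rw [LinearMap.smul_comp, LinearMap.comp_smul, RingHom.id_apply] }
  map_one' := by
    refine LinearMap.ext fun f => ?_
    simp [quotAct_one, lineAct_one]
  map_mul' := fun g g' => by
    refine LinearMap.ext fun f => ?_
    simp [quotAct_mul, lineAct_mul, LinearMap.comp_assoc]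

end Lattice

/-- `A` is a quasi-reflection: its fixed space is a hyperplane. For `A` of finite order this says
that all but exactly one of its eigenvalues, counted with multiplicity, are `1`. -/
def IsQuasiReflection {M : Type*} [AddCommGroup M] [Module ℂ M] (A : Module.End ℂ M) : Prop :=
  Module.finrank ℂ (A.eigenspace 1) + 1 = Module.finrank ℂ M

/-- The Reid-Tai sum of an endomorphism `A` of finite order `l`, with respect to a primitive `l`-th
root of unity `ζ`: the sum of `a / l` over the eigenvalues `ζ ^ a` (`0 ≤ a < l`) of `A`, counted
with multiplicity. Endomorphisms of finite order are diagonalisable, so that the multiplicity is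
the dimension of the eigenspace. -/
noncomputable def reidTaiSum {M : Type*} [AddCommGroup M] [Module ℂ M] (A : Module.End ℂ M)
    (ζ : ℂ) : ℚ :=
  ∑ a ∈ Finset.range (orderOf A),
    (Module.finrank ℂ (A.eigenspace (ζ ^ a)) : ℚ) * ((a : ℚ) / (orderOf A : ℚ))

end BallQuotient

/-! An isometry of `Λ` that stabilises a negative line also preserves the positive definite form
obtained by changing the sign of `h` on that line. The matrices of its powers then have entries in a
finite subset of `𝓞`, so `g ^ N = 1` for some `N > 0`. Choose a primitive `N`-th root of unity `ξ`
with `ξ ^ (N / l) = ζ`, let `w b` be the multiplicity of `ξ ^ b` on `Λ_ℂ`, and let `ξ ^ j` be the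
eigenvalue on `𝕎`. The eigenvalues on `V` are the `ξ ^ (b - j)`, one copy of `b = j` being used up
by `𝕎`, so the claim becomes `N ≤ ∑ b, w b * (b - j).val`, which is `IsQuadraticInvariant.le_sum`.

The characteristic polynomial of `g` has coefficients in `ℚ(√D)`, so `w` is invariant under the
automorphisms of the algebraic numbers fixing `√D`. Complex conjugation negates `√D` and inverts
roots of unity; hence for each unit `u` modulo `d`, at least one of `u`, `-u` preserves `w` on
`d`-torsion. Since `D < -3`, the field `ℚ(√D)` is contained in neither the 8th nor the 12th
cyclotomic field, so `-1` preserves `w` on 8- and 12-torsion. This is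
`isQuadraticInvariant_rootMultiplicity`.

An eigenvalue of order `d` thus brings along at least half of the primitive `d`-th roots of unity.
For large `d` these alone give the bound for every `j`, by a totient estimate; finitely many `d` are
checked by computation. Besides 1 and 2, only `exceptionalOrders` escape. When no other orders
occur, there are two cases. If `ξ ^ j = ±1`, one exceptional orbit suffices; without any, every
eigenvalue is `±1`, and two differ from `ξ ^ j` because `g` is neither trivial nor a
quasi-reflection on `V`. If `ξ ^ j` has exceptional order, its own orbit is counted exactly, and the
other eigenvalues, at least 12 minus the size of that orbit in number since `n ≥ 11`, make up the
rest through a lower bound on their average contribution. -/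

namespace BallQuotient

/-! ### Residue sums over orbits of units in `ZMod N`. -/

section Arithmetic

variable {N : ℕ}

/-- Multiplication by `u` preserves the function `w` on the `d`-torsion of `ZMod N`. -/
def MulInvariant (w : ZMod N → ℕ) (d : ℕ) (u : ℤ) : Prop :=
  ∀ b : ZMod N, (d : ZMod N) * b = 0 → w (u * b) = w b

theorem MulInvariant.mul {w : ZMod N → ℕ} {d : ℕ} {u v : ℤ} (hu : MulInvariant w d u)
    (hv : MulInvariant w d v) : MulInvariant w d (u * v) := by
  intro b hb
  rw [Int.cast_mul, mul_assoc, hu _ (by rw [mul_left_comm, hb, mul_zero]), hv b hb]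

theorem MulInvariant.one (w : ZMod N → ℕ) (d : ℕ) : MulInvariant w d 1 := by
  intro b _
  simp

theorem MulInvariant.pow {w : ZMod N → ℕ} {d : ℕ} {u : ℤ} (hu : MulInvariant w d u) (k : ℕ) :
    MulInvariant w d (u ^ k) := by
  induction k with
  | zero => simpa using MulInvariant.one w d
  | succ k ih => rw [pow_succ]; exact ih.mul hu

theorem MulInvariant.mono {w : ZMod N → ℕ} {d d' : ℕ} {u : ℤ} (hu : MulInvariant w d u)
    (hd : d' ∣ d) : MulInvariant w d' u := by
  obtain ⟨k, rfl⟩ := hd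
  intro b hb
  refine hu b ?_
  push_cast
  linear_combination (k : ZMod N) * hb

theorem natCast_addOrderOf_mul (b : ZMod N) : (addOrderOf b : ZMod N) * b = 0 := by
  rw [← nsmul_eq_mul, addOrderOf_nsmul_eq_zero]

variable [NeZero N]

theorem exists_eq_of_addOrderOf {b : ZMod N} {d : ℕ} (hb : addOrderOf b = d) :
    ∃ e c : ℕ, 0 < d ∧ N = d * e ∧ c < d ∧ c.Coprime d ∧ b = ((e * c : ℤ) : ZMod N) := by
  have hN : 0 < N := Nat.pos_of_ne_zero (NeZero.ne N)
  have h1 := ZMod.addOrderOf_coe b.val (NeZero.ne N)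
  rw [ZMod.natCast_zmod_val, hb] at h1
  have hg : 0 < N.gcd b.val := Nat.gcd_pos_of_pos_left _ hN
  have hNd : N = d * N.gcd b.val := by rw [h1, Nat.div_mul_cancel (Nat.gcd_dvd_left _ _)]
  have hc : N.gcd b.val * (b.val / N.gcd b.val) = b.val :=
    Nat.mul_div_cancel' (Nat.gcd_dvd_right _ _)
  refine ⟨N.gcd b.val, b.val / N.gcd b.val, ?_, hNd, ?_, ?_, ?_⟩
  · exact Nat.pos_of_mul_pos_right (hNd ▸ hN)
  · have := ZMod.val_lt b
    rw [Nat.div_lt_iff_lt_mul hg, ← hNd]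
    exact this
  · rw [h1]
    exact (Nat.coprime_div_gcd_div_gcd hg).symm
  · rw [← Nat.cast_mul, hc]
    simp

theorem val_intCast_mul {d e : ℕ} (hN : N = d * e) (k : ℤ) :
    ((((e * k : ℤ) : ZMod N).val : ℕ) : ℤ) = e * (k % d) := by
  rw [ZMod.val_intCast, hN]
  push_cast
  have he : 0 < e := by
    rcases Nat.eq_zero_or_pos e with rfl | he
    · exact absurd (by simpa using hN) (NeZero.ne N)
    · exact he
  rw [mul_comm (d : ℤ), Int.mul_emod_mul_of_pos _ _ (by exact_mod_cast he)]

/-- Moving the base point from `j` forward to the first point of the family shortens every cyclic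
distance. This reduces an arbitrary `j` to finitely many cases, independent of `N`. -/
theorem exists_sum_val_sub_le {ι : Type*} (A : Finset ι) (hA : A.Nonempty) (x : ι → ZMod N)
    (j : ZMod N) : ∃ i₀ ∈ A, ∑ i ∈ A, ((x i - x i₀).val : ℤ) ≤ ∑ i ∈ A, ((x i - j).val : ℤ) := by
  obtain ⟨i₀, hi₀, hmin⟩ := A.exists_min_image (fun i => (x i - j).val) hA
  refine ⟨i₀, hi₀, Finset.sum_le_sum fun i hi => ?_⟩
  have h1 : x i - x i₀ = (x i - j) - (x i₀ - j) := by ring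
  rw [h1, ZMod.val_sub (hmin i hi)]
  exact_mod_cast Nat.sub_le _ _

theorem sum_le_sum_mul_val {ι : Type*} (w : ZMod N → ℕ) (j : ZMod N) (A : Finset ι)
    (x : ι → ZMod N) (hx : Set.InjOn x A) (hw : ∀ i ∈ A, 1 ≤ w (x i)) :
    ∑ i ∈ A, ((x i - j).val : ℤ) ≤ ∑ b, (w b : ℤ) * ((b - j).val : ℤ) := by
  classical
  rw [← Finset.sum_image (f := fun b : ZMod N => ((b - j).val : ℤ)) hx]
  refine (Finset.sum_le_sum fun b hb => ?_).trans
    (Finset.sum_le_sum_of_subset_of_nonneg (Finset.subset_univ _) fun b _ _ => by positivity)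
  obtain ⟨i, hi, rfl⟩ := Finset.mem_image.1 hb
  have := hw i hi
  exact le_mul_of_one_le_left (by positivity) (by exact_mod_cast this)

theorem le_sum_val_of_orbit {d e c : ℕ} (hN : N = d * e) (hcd : c < d) (hc : c.Coprime d)
    (L : Finset ℤ) (hL : L.Nonempty) (B : ℤ)
    (hB : ∀ c ∈ Finset.range d, c.Coprime d → ∀ u₀ ∈ L, B ≤ ∑ u ∈ L, (u - u₀) * c % d)
    (j : ZMod N) :
    e * B ≤ ∑ u ∈ L, (((u : ZMod N) * ((e * c : ℤ) : ZMod N) - j).val : ℤ) := by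
  obtain ⟨u₀, hu₀, hle⟩ := exists_sum_val_sub_le L hL
    (fun u : ℤ => (u : ZMod N) * ((e * c : ℤ) : ZMod N)) j
  refine le_trans ?_ hle
  have h1 : ∀ u : ℤ, (u : ZMod N) * ((e * c : ℤ) : ZMod N) -
      (u₀ : ZMod N) * ((e * c : ℤ) : ZMod N) = ((e * ((u - u₀) * c) : ℤ) : ZMod N) := by
    intro u; push_cast; ring
  simp only [h1, val_intCast_mul hN]
  rw [← Finset.mul_sum]
  exact mul_le_mul_of_nonneg_left (hB c (Finset.mem_range.2 hcd) hc u₀ hu₀) (by positivity)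

theorem intCast_mul_inj {d e c : ℕ} (hN : N = d * e) (hc : c.Coprime d) (u v : ℤ)
    (h : (u : ZMod N) * ((e * c : ℤ) : ZMod N) = v * ((e * c : ℤ) : ZMod N)) :
    (d : ℤ) ∣ v - u := by
  have he : (e : ℤ) ≠ 0 := by
    rintro he
    have : e = 0 := by exact_mod_cast he
    exact NeZero.ne N (by rw [hN, this, mul_zero])
  rw [← Int.cast_mul, ← Int.cast_mul, ZMod.intCast_eq_intCast_iff_dvd_sub] at h
  have h2 : ((d * e : ℕ) : ℤ) ∣ e * ((v - u) * c) := by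
    rw [← hN]; convert h using 1; ring
  push_cast at h2
  rw [mul_comm (d : ℤ)] at h2
  exact IsCoprime.dvd_of_dvd_mul_right (Nat.Coprime.isCoprime hc.symm)
    (Int.dvd_of_mul_dvd_mul_left he h2)

theorem le_sum_of_orbit (w : ZMod N → ℕ) (j : ZMod N) {d : ℕ} (L : Finset ℤ) (hL : L.Nonempty)
    (hinv : ∀ u ∈ L, MulInvariant w d u)
    (hdist : ∀ u ∈ L, ∀ v ∈ L, (d : ℤ) ∣ v - u → u = v)
    (hB : ∀ c ∈ Finset.range d, c.Coprime d → ∀ u₀ ∈ L, (d : ℤ) ≤ ∑ u ∈ L, (u - u₀) * c % d)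
    {b : ZMod N} (hb : addOrderOf b = d) (hw : 1 ≤ w b) :
    (N : ℤ) ≤ ∑ b, (w b : ℤ) * ((b - j).val : ℤ) := by
  have htor := natCast_addOrderOf_mul b
  rw [hb] at htor
  obtain ⟨e, c, hd, hN, hcd, hc, rfl⟩ := exists_eq_of_addOrderOf hb
  have h1 := le_sum_val_of_orbit hN hcd hc L hL d hB j
  have h2 := sum_le_sum_mul_val w j L (fun u : ℤ => (u : ZMod N) * ((e * c : ℤ) : ZMod N))
    (fun u hu v hv h => hdist u hu v hv (intCast_mul_inj hN hc u v h))
    (fun u hu => by rw [hinv u hu _ htor]; exact hw)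
  refine le_trans (le_of_eq ?_) (h1.trans h2)
  rw [hN]; push_cast; ring

/-- For general `d` no explicit group of units is available. Instead `A` collects every unit whose
residue carries positive weight; it meets each pair `{x, -x}`, hence has at least half of all units.
-/
theorem exists_units_sum_le (w : ZMod N → ℕ) (j : ZMod N) {d : ℕ} [NeZero d]
    (hinv : ∀ u : ℤ, IsCoprime u d → MulInvariant w d u ∨ MulInvariant w d (-u))
    {b : ZMod N} (hb : addOrderOf b = d) (hw : 1 ≤ w b) :
    ∃ e : ℕ, N = d * e ∧ ∃ A : Finset (ZMod d)ˣ, d.totient ≤ 2 * A.card ∧ ∃ x₀ ∈ A,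
      e * ∑ x ∈ A, (((x : ZMod d).val : ℤ) - ((x₀ : ZMod d).val : ℤ)) % d ≤
        ∑ b, (w b : ℤ) * ((b - j).val : ℤ) := by
  classical
  have htor := natCast_addOrderOf_mul b
  rw [hb] at htor
  obtain ⟨e, c, hd, hN, hcd, hc, rfl⟩ := exists_eq_of_addOrderOf hb
  let y : (ZMod d)ˣ → ZMod N := fun x => ((e * ((x : ZMod d).val : ℤ) : ℤ) : ZMod N)
  have hy : ∀ (x : (ZMod d)ˣ) (k : ℤ), (x : ZMod d) = k → y x = ((e * k : ℤ) : ZMod N) := by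
    intro x k hk
    change ((e * ((x : ZMod d).val : ℤ) : ℤ) : ZMod N) = _
    rw [ZMod.intCast_eq_intCast_iff_dvd_sub, ← mul_sub, hN]
    push_cast
    rw [mul_comm (d : ℤ)]
    refine mul_dvd_mul_left _ ?_
    rw [← ZMod.intCast_eq_intCast_iff_dvd_sub, ← hk]
    simp
  let A : Finset (ZMod d)ˣ := Finset.univ.filter fun x => 1 ≤ w (y x)
  let c' : (ZMod d)ˣ := ZMod.unitOfCoprime c hc
  have hc' : (c' : ZMod d) = ((c : ℤ) : ZMod d) := by simp [c']
  have hmem : ∀ x : (ZMod d)ˣ, x ∈ A ∨ -x ∈ A := by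
    intro x
    let u : (ZMod d)ˣ := x * c'⁻¹
    have hux : x = u * c' := by simp [u]
    have hucop : IsCoprime (((u : ZMod d).val : ℕ) : ℤ) (d : ℤ) :=
      Nat.Coprime.isCoprime (ZMod.val_coe_unit_coprime u)
    rcases hinv _ hucop with h | h
    · left
      have h1 : y x = (((u : ZMod d).val : ℤ) : ZMod N) * ((e * c : ℤ) : ZMod N) := by
        rw [hy x ((u : ZMod d).val * c : ℤ) (by rw [hux]; simp [hc'])]
        push_cast; ring
      simp only [A, Finset.mem_filter, Finset.mem_univ, true_and]
      rw [h1, h _ htor]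
      exact hw
    · right
      have h1 : y (-x) = ((-((u : ZMod d).val : ℤ) : ℤ) : ZMod N) * ((e * c : ℤ) : ZMod N) := by
        rw [hy (-x) (-(u : ZMod d).val * c : ℤ) (by rw [hux]; simp [hc'])]
        push_cast; ring
      simp only [A, Finset.mem_filter, Finset.mem_univ, true_and]
      rw [h1, h _ htor]
      exact hw
  have hcard : d.totient ≤ 2 * A.card := by
    have h1 : (Finset.univ : Finset (ZMod d)ˣ) ⊆ A ∪ A.image (fun x => -x) := by
      intro x _
      rcases hmem x with h | h
      · exact Finset.mem_union_left _ h
      · exact Finset.mem_union_right _ (Finset.mem_image.2 ⟨-x, h, neg_neg x⟩)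
    have h2 := Finset.card_le_card h1
    rw [Finset.card_univ, ZMod.card_units_eq_totient] at h2
    have h3 := Finset.card_union_le A (A.image fun x => -x)
    have h4 : (A.image fun x => -x).card ≤ A.card := Finset.card_image_le
    omega
  have hA : A.Nonempty := by
    rcases hmem 1 with h | h
    · exact ⟨_, h⟩
    · exact ⟨_, h⟩
  obtain ⟨x₀, hx₀, hle⟩ := exists_sum_val_sub_le A hA y j
  refine ⟨e, hN, A, hcard, x₀, hx₀, ?_⟩
  have hinj : Set.InjOn y A := by
    intro x _ x' _ hxx
    change ((e * ((x : ZMod d).val : ℤ) : ℤ) : ZMod N) =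
      ((e * ((x' : ZMod d).val : ℤ) : ℤ) : ZMod N) at hxx
    have h1 := intCast_mul_inj (c := 1) hN (Nat.coprime_one_left d)
      ((x : ZMod d).val : ℤ) ((x' : ZMod d).val : ℤ)
      (by rw [← Int.cast_mul, ← Int.cast_mul]; simpa [mul_comm] using hxx)
    rw [← ZMod.intCast_eq_intCast_iff_dvd_sub] at h1
    ext
    simpa using h1
  refine le_trans ?_ (hle.trans (sum_le_sum_mul_val w j A y hinj
    fun x hx => (Finset.mem_filter.1 hx).2))
  rw [Finset.mul_sum]
  refine Finset.sum_le_sum fun x _ => le_of_eq ?_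
  rw [← val_intCast_mul hN]
  congr 3
  simp only [y]
  push_cast; ring

end Arithmetic

/-! ### Large orders: totient estimates. -/

theorem card_mul_card_sub_one_le (K : Finset ℕ) :
    (K.card : ℤ) * (K.card - 1) ≤ 2 * ∑ k ∈ K, (k : ℤ) := by
  induction K using Finset.induction_on_max with
  | empty => simp
  | insert a K hK ih =>
    have ha : a ∉ K := fun h => lt_irrefl _ (hK a h)
    rw [Finset.card_insert_of_notMem ha, Finset.sum_insert ha]
    have : K.card ≤ a := by
      simpa using Finset.card_le_card (fun x hx => Finset.mem_range.2 (hK x hx) : K ⊆ Finset.range a)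
    have h2 : (K.card : ℤ) ≤ a := by exact_mod_cast this
    push_cast
    linarith

theorem card_mul_le_sum_add {ι : Type*} (t : ℤ) (A : Finset ι) (f : ι → ℤ) :
    A.card * t ≤ ∑ i ∈ A, f i + ∑ i ∈ A, max 0 (t - f i) := by
  rw [← Finset.sum_add_distrib, ← nsmul_eq_mul, ← Finset.sum_const]
  refine Finset.sum_le_sum fun i _ => ?_
  have := le_max_right 0 (t - f i)
  linarith

theorem prime_pow_totient_bound {p k : ℕ} (hp : p.Prime) (hk : 0 < k) {a b : ℕ}
    (h : b * p ^ 3 ≤ a * (p - 1) ^ 4) :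
    b * (p ^ k) ^ 3 ≤ a * (p ^ k).totient ^ 4 := by
  rw [Nat.totient_prime_pow hp hk]
  obtain ⟨k, rfl⟩ : ∃ m, k = m + 1 := ⟨k - 1, by omega⟩
  simp only [Nat.add_sub_cancel]
  have h1 : (p ^ k) ^ 3 * 1 ≤ (p ^ k) ^ 3 * p ^ k := by
    gcongr
    exact Nat.one_le_pow _ _ hp.pos
  calc b * (p ^ (k + 1)) ^ 3 = b * p ^ 3 * ((p ^ k) ^ 3 * 1) := by ring
    _ ≤ a * (p - 1) ^ 4 * ((p ^ k) ^ 3 * p ^ k) := Nat.mul_le_mul h h1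
    _ = a * (p ^ k * (p - 1)) ^ 4 := by ring

/-- The quotient `n ^ 3 / φ(n) ^ 4` is multiplicative and, on powers of a prime `p`, largest at `p`
itself, with value `p ^ 3 / (p - 1) ^ 4`. This is 8 for `p = 2`, 27/16 for `p = 3`, and less than 1
from `p = 5` on. -/
theorem totient_bound_aux (n : ℕ) :
    (if 3 ∣ n then 16 else 1) * n ^ 3 ≤
      (if 2 ∣ n then 8 else 1) * (if 3 ∣ n then 27 else 1) * n.totient ^ 4 := by
  induction n using Nat.recOnPosPrimePosCoprime with
  | prime_pow p k hp hk =>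
    have h2 : 2 ∣ p ^ k ↔ p = 2 := by
      rw [Nat.prime_two.prime.dvd_pow_iff_dvd hk.ne', Nat.prime_dvd_prime_iff_eq Nat.prime_two hp, eq_comm]
    have h3 : 3 ∣ p ^ k ↔ p = 3 := by
      rw [Nat.prime_three.prime.dvd_pow_iff_dvd hk.ne', Nat.prime_dvd_prime_iff_eq Nat.prime_three hp,
        eq_comm]
    simp only [h2, h3]
    apply prime_pow_totient_bound hp hk
    rcases eq_or_ne p 2 with rfl | hp2
    · norm_num
    rcases eq_or_ne p 3 with rfl | hp3
    · norm_num
    simp only [hp2, hp3, if_false, one_mul]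
    have h4 : p ≠ 4 := by rintro rfl; revert hp; decide
    obtain ⟨m, rfl⟩ : ∃ m, p = m + 5 := ⟨p - 5, by have := hp.two_le; omega⟩
    simp only [show m + 5 - 1 = m + 4 by omega]
    calc (m + 5) ^ 3 ≤ (m + 5) ^ 3 + (m ^ 4 + 15 * m ^ 3 + 81 * m ^ 2 + 181 * m + 131) := by omega
      _ = (m + 4) ^ 4 := by ring
  | zero => simp
  | one => simp
  | coprime a b _ _ hab iha ihb =>
    have h2 : ¬ (2 ∣ a ∧ 2 ∣ b) := fun h => Nat.Prime.not_coprime_iff_dvd.2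
      ⟨2, Nat.prime_two, h.1, h.2⟩ hab
    have h3 : ¬ (3 ∣ a ∧ 3 ∣ b) := fun h => Nat.Prime.not_coprime_iff_dvd.2
      ⟨3, Nat.prime_three, h.1, h.2⟩ hab
    rw [Nat.totient_mul hab]
    simp only [Nat.prime_two.dvd_mul, Nat.prime_three.dvd_mul]
    have := Nat.mul_le_mul iha ihb
    by_cases a2 : 2 ∣ a <;> by_cases b2 : 2 ∣ b <;> by_cases a3 : 3 ∣ a <;> by_cases b3 : 3 ∣ b <;>
      simp only [a2, b2, a3, b3, if_true, if_false, or_true, true_or, or_self, and_self,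
        not_true_eq_false] at this h2 h3 ⊢ <;> nlinarith

theorem totient_bound (n : ℕ) : 2 * n ^ 3 ≤ 27 * n.totient ^ 4 := by
  have := totient_bound_aux n
  have h0 : 0 ≤ n.totient ^ 4 := Nat.zero_le _
  split_ifs at this <;> nlinarith

theorem totient_bound_odd {n : ℕ} (hn : ¬ 2 ∣ n) : 16 * n ^ 3 ≤ 27 * n.totient ^ 4 := by
  have := totient_bound_aux n
  have h0 : 0 ≤ n.totient ^ 4 := Nat.zero_le _
  simp only [hn, if_false] at this
  split_ifs at this <;> nlinarith

theorem totient_mul_totient_sub_two_small :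
    ∀ d ∈ Finset.range 300, d ∉ ({0, 1, 2, 3, 4, 5, 6, 7, 8, 9, 10, 11, 12, 14, 15, 16, 18, 20, 21,
      22, 24, 30, 36, 42, 60} : Finset ℕ) →
      (if 2 ∣ d then 4 * d else 8 * d) + 2 * d.totient ≤ d.totient * d.totient := by
  decide +kernel

theorem totient_mul_totient_sub_two_large {d : ℕ} (hd : 300 ≤ d) :
    (if 2 ∣ d then 4 * d else 8 * d) + 2 * d.totient ≤ d.totient * d.totient := by
  by_contra! hlt
  have h1 := totient_bound d
  have h2 := @totient_bound_odd d
  generalize d.totient = f at *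
  split_ifs at hlt with hd2
  -- If `d < 8 * f`, the negated claim gives `f ^ 2 < 34 * f`, so `d < 272`. Otherwise the linear
  -- term is absorbed into `17 * d`, and `2 * d ^ 3 ≤ 27 * f ^ 4` forces `d < 244`. Both contradict
  -- `300 ≤ d`; the odd case is similar.
  · have hf : 8 * f ≤ d := by
      by_contra! h
      have : f < 34 := by nlinarith
      omega
    have h3 : 4 * (f * f) ≤ 17 * d := by linarith
    have h4 : (4 * (f * f)) * (4 * (f * f)) ≤ (17 * d) * (17 * d) := Nat.mul_le_mul h3 h3
    have h5 : 300 * (d * d) ≤ d * (d * d) := Nat.mul_le_mul_right _ hd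
    have h6 : 0 < d * d := by positivity
    have h7 : f ^ 4 = (f * f) * (f * f) := by ring
    have h8 : d ^ 3 = d * (d * d) := by ring
    rw [h7, h8] at h1
    linarith
  · have hf : 4 * f ≤ d := by
      by_contra! h
      have : f < 34 := by nlinarith
      omega
    have h3 : 2 * (f * f) ≤ 17 * d := by linarith
    have h4 : (2 * (f * f)) * (2 * (f * f)) ≤ (17 * d) * (17 * d) := Nat.mul_le_mul h3 h3
    have h5 : 300 * (d * d) ≤ d * (d * d) := Nat.mul_le_mul_right _ hd
    have h6 : 0 < d * d := by positivity
    have h7 : f ^ 4 = (f * f) * (f * f) := by ring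
    have h8 : d ^ 3 = d * (d * d) := by ring
    have h2 := h2 hd2
    rw [h7, h8] at h2
    linarith

theorem sub_emod_injective {d : ℕ} [NeZero d] (x₀ : (ZMod d)ˣ) :
    Function.Injective fun x : (ZMod d)ˣ =>
      ((((x : ZMod d).val : ℤ) - ((x₀ : ZMod d).val : ℤ)) % d).toNat := by
  intro x y hxy
  have hd : (d : ℤ) ≠ 0 := by exact_mod_cast NeZero.ne d
  have h1 : (((x : ZMod d).val : ℤ) - ((x₀ : ZMod d).val : ℤ)) % d =
      (((y : ZMod d).val : ℤ) - ((x₀ : ZMod d).val : ℤ)) % d := by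
    have := congrArg (Nat.cast : ℕ → ℤ) hxy
    simpa [Int.toNat_of_nonneg (Int.emod_nonneg _ hd)] using this
  have h2 := (ZMod.intCast_eq_intCast_iff _ _ d).2 h1
  ext
  simpa using h2

/-- With `m ≥ φ(d) / 2` distinct nonnegative residues the sum is at least `m (m - 1) / 2`. For even
`d` all units are odd, their differences are even, and the bound doubles; hence the two constants 4
and 8. -/
theorem le_sum_of_totient {d : ℕ} [NeZero d]
    (hd : (if 2 ∣ d then 4 * d else 8 * d) + 2 * d.totient ≤ d.totient * d.totient)
    (A : Finset (ZMod d)ˣ) (hA : d.totient ≤ 2 * A.card) (x₀ : (ZMod d)ˣ) :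
    (d : ℤ) ≤ ∑ x ∈ A, (((x : ZMod d).val : ℤ) - ((x₀ : ZMod d).val : ℤ)) % d := by
  have hd0 : (d : ℤ) ≠ 0 := by exact_mod_cast NeZero.ne d
  set k : (ZMod d)ˣ → ℕ := fun x =>
      ((((x : ZMod d).val : ℤ) - ((x₀ : ZMod d).val : ℤ)) % d).toNat with hk
  have hkinj : Function.Injective k := sub_emod_injective x₀
  have hkc : ∀ x : (ZMod d)ˣ,
      (((x : ZMod d).val : ℤ) - ((x₀ : ZMod d).val : ℤ)) % d = (k x : ℤ) := fun x =>
    (Int.toNat_of_nonneg (Int.emod_nonneg _ hd0)).symm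
  simp only [hkc]
  have hm : (d.totient : ℤ) ≤ 2 * A.card := by exact_mod_cast hA
  have hm2 : (2 : ℤ) ≤ d.totient := by
    have h0 : 0 < d.totient := Nat.totient_pos.2 (Nat.pos_of_ne_zero (NeZero.ne d))
    have : 2 ≤ d.totient := by
      by_contra! h
      have h1 : d.totient = 1 := by omega
      rw [h1] at hd
      omega
    exact_mod_cast this
  split_ifs at hd with h2
  · have heven : ∀ x, k x = 2 * (k x / 2) := by
      intro x
      have hodd : ∀ y : (ZMod d)ˣ, ((y : ZMod d).val : ℤ) % 2 = 1 := by
        intro y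
        have h3 : ((y : ZMod d).val).Coprime 2 :=
          (ZMod.val_coe_unit_coprime y).coprime_dvd_right h2
        have h4 := Nat.coprime_two_right.1 h3
        have := Nat.odd_iff.1 h4
        omega
      have h5 := hkc x
      have h6 : ((((x : ZMod d).val : ℤ) - ((x₀ : ZMod d).val : ℤ)) % d) % 2 = 0 := by
        rw [Int.emod_emod_of_dvd _ (by exact_mod_cast h2)]
        have := hodd x
        have := hodd x₀
        omega
      omega
    have hinj : Set.InjOn (fun x => k x / 2) A := by
      intro x _ y _ hxy
      simp only at hxy
      have := heven x
      have := heven y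
      exact hkinj (by omega)
    have h3 := card_mul_card_sub_one_le (A.image fun x => k x / 2)
    rw [Finset.card_image_of_injOn hinj, Finset.sum_image hinj, Finset.mul_sum] at h3
    have h4 : ∀ x ∈ A, (2 : ℤ) * ((k x / 2 : ℕ) : ℤ) = k x := by
      intro x _
      have := heven x
      omega
    rw [Finset.sum_congr rfl h4] at h3
    have hd' : (4 * d + 2 * d.totient : ℤ) ≤ d.totient * d.totient := by exact_mod_cast hd
    nlinarith
  · have h3 := card_mul_card_sub_one_le (A.image k)
    rw [Finset.card_image_of_injective _ hkinj, Finset.sum_image hkinj.injOn] at h3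
    have hd' : (8 * d + 2 * d.totient : ℤ) ≤ d.totient * d.totient := by exact_mod_cast hd
    nlinarith

/-- A relaxation of minimising over all half-size subsets: each residue `r` satisfies `r ≥ t - max 0
(t - r)`, and the deficits may be summed over all units. It avoids enumerating subsets for the four
orders 21, 36, 42, 60 that the totient estimate misses. -/
theorem le_sum_of_threshold {d : ℕ} [NeZero d] (t : ℤ) (m : ℕ) (hm : d.totient = 2 * m)
    (ht : 0 ≤ t)
    (hd : ∀ c₀ ∈ Finset.range d, c₀.Coprime d →
      (d : ℤ) + ∑ c ∈ (Finset.range d).filter (fun c => c.Coprime d),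
        max 0 (t - ((c : ℤ) - c₀) % d) ≤ m * t)
    (A : Finset (ZMod d)ˣ) (hA : d.totient ≤ 2 * A.card) (x₀ : (ZMod d)ˣ) :
    (d : ℤ) ≤ ∑ x ∈ A, (((x : ZMod d).val : ℤ) - ((x₀ : ZMod d).val : ℤ)) % d := by
  classical
  have h1 := card_mul_le_sum_add t A
    (fun x => (((x : ZMod d).val : ℤ) - ((x₀ : ZMod d).val : ℤ)) % d)
  have hinj : Set.InjOn (fun x : (ZMod d)ˣ => (x : ZMod d).val) A :=
    fun x _ y _ h => Units.ext (ZMod.val_injective d h)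
  have h2 : ∑ x ∈ A, max 0 (t - (((x : ZMod d).val : ℤ) - ((x₀ : ZMod d).val : ℤ)) % d) ≤
      ∑ c ∈ (Finset.range d).filter (fun c => c.Coprime d),
        max 0 (t - ((c : ℤ) - ((x₀ : ZMod d).val : ℕ)) % d) := by
    rw [← Finset.sum_image (g := fun x : (ZMod d)ˣ => (x : ZMod d).val)
      (f := fun c : ℕ => max 0 (t - ((c : ℤ) - ((x₀ : ZMod d).val : ℕ)) % d)) hinj]
    refine Finset.sum_le_sum_of_subset_of_nonneg ?_ fun _ _ _ => le_max_left _ _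
    intro c hc
    obtain ⟨x, -, rfl⟩ := Finset.mem_image.1 hc
    exact Finset.mem_filter.2 ⟨Finset.mem_range.2 (ZMod.val_lt _), ZMod.val_coe_unit_coprime x⟩
  have h3 := hd _ (Finset.mem_range.2 (ZMod.val_lt (x₀ : ZMod d))) (ZMod.val_coe_unit_coprime x₀)
  have h4 : (m : ℤ) ≤ A.card := by
    have : m ≤ A.card := by omega
    exact_mod_cast this
  nlinarith

/-- The orders of roots of unity with few conjugates. -/
def smallOrders : Finset ℕ :=
  {1, 2, 3, 4, 5, 6, 7, 8, 9, 10, 11, 12, 14, 15, 16, 18, 20, 22, 24, 30}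

theorem le_sum_of_notMem_smallOrders {d : ℕ} [NeZero d] (hd : d ∉ smallOrders)
    (A : Finset (ZMod d)ˣ) (hA : d.totient ≤ 2 * A.card) (x₀ : (ZMod d)ˣ) :
    (d : ℤ) ≤ ∑ x ∈ A, (((x : ZMod d).val : ℤ) - ((x₀ : ZMod d).val : ℤ)) % d := by
  by_cases h21 : d = 21
  · subst h21
    exact le_sum_of_threshold 8 6 (by decide +kernel) (by norm_num) (by decide +kernel) A hA x₀
  by_cases h36 : d = 36
  · subst h36
    exact le_sum_of_threshold 12 6 (by decide +kernel) (by norm_num) (by decide +kernel) A hA x₀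
  by_cases h42 : d = 42
  · subst h42
    exact le_sum_of_threshold 16 6 (by decide +kernel) (by norm_num) (by decide +kernel) A hA x₀
  by_cases h60 : d = 60
  · subst h60
    exact le_sum_of_threshold 20 8 (by decide +kernel) (by norm_num) (by decide +kernel) A hA x₀
  refine le_sum_of_totient ?_ A hA x₀
  by_cases h300 : 300 ≤ d
  · exact totient_mul_totient_sub_two_large h300
  · refine totient_mul_totient_sub_two_small d (Finset.mem_range.2 (by omega)) ?_
    have h0 := NeZero.ne d
    simp only [smallOrders, Finset.mem_insert, Finset.mem_singleton, not_or] at hd ⊢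
    tauto

/-! ### Small orders: explicit unit groups and finite checks. -/

/-- The orders of roots of unity having orbits whose Reid-Tai sum is less than `1`. -/
def exceptionalOrders : Finset ℕ := {3, 4, 6, 7, 14, 15, 20, 24, 30}

/-- A set of integers representing a group of units modulo `d` whose orbits satisfy the numerical
estimates needed for the Reid-Tai sum. -/
structure AdmissibleUnits (d : ℕ) (L : Finset ℤ) : Prop where
  one_mem : 1 ∈ L
  card_le : L.card ≤ 12
  mul_mem : ∀ u ∈ L, ∀ v ∈ L, ∃ x ∈ L, (d : ℤ) ∣ x - u * v
  inv_mem : ∀ u ∈ L, ∃ x ∈ L, (d : ℤ) ∣ x * u - 1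
  distinct : ∀ u ∈ L, ∀ v ∈ L, (d : ℤ) ∣ v - u → u = v
  -- For any base point, an element of the orbit contributes on average at least 1/6; the `+ 5`
  -- rounds the quotient up.
  bound_any : ∀ c ∈ Finset.range d, c.Coprime d → ∀ u₀ ∈ L,
    (L.card * d + 5) / 6 ≤ ∑ u ∈ L, (u - u₀) * c % d
  bound_zero : ∀ c ∈ Finset.range d, c.Coprime d → (d : ℤ) ≤ ∑ u ∈ L, u * c % d
  -- The base eigenvalue is `-1`; everything is doubled because `d / 2` need not be an integer.
  bound_half : ∀ c ∈ Finset.range d, c.Coprime d →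
    (2 * d : ℤ) ≤ ∑ u ∈ L, (2 * (u * c) - d) % (2 * d)
  -- The base eigenvalue lies in the orbit itself, and `12 - L.card` further eigenvalues contribute
  -- at least `x / 6` each. The three values of `x` stand for the average 1/6, the eigenvalue `1`
  -- and the eigenvalue `-1`.
  bound_self : ∀ c ∈ Finset.range d, c.Coprime d →
    ∀ x ∈ ({(d : ℤ), 6 * (-(c : ℤ) % d), 3 * ((2 * (-(c : ℤ)) - d) % (2 * d))} : Finset ℤ),
      (6 * d : ℤ) ≤ 6 * ∑ u ∈ L, (u - 1) * c % d + (12 - L.card) * x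

theorem admissibleUnits_iff (d : ℕ) (L : Finset ℤ) : AdmissibleUnits d L ↔
    1 ∈ L ∧ L.card ≤ 12 ∧ (∀ u ∈ L, ∀ v ∈ L, ∃ x ∈ L, (d : ℤ) ∣ x - u * v) ∧
    (∀ u ∈ L, ∃ x ∈ L, (d : ℤ) ∣ x * u - 1) ∧
    (∀ u ∈ L, ∀ v ∈ L, (d : ℤ) ∣ v - u → u = v) ∧
    (∀ c ∈ Finset.range d, c.Coprime d → ∀ u₀ ∈ L,
      ((L.card * d + 5) / 6 : ℤ) ≤ ∑ u ∈ L, (u - u₀) * c % d) ∧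
    (∀ c ∈ Finset.range d, c.Coprime d → (d : ℤ) ≤ ∑ u ∈ L, u * c % d) ∧
    (∀ c ∈ Finset.range d, c.Coprime d →
      (2 * d : ℤ) ≤ ∑ u ∈ L, (2 * (u * c) - d) % (2 * d)) ∧
    (∀ c ∈ Finset.range d, c.Coprime d →
      ∀ x ∈ ({(d : ℤ), 6 * (-(c : ℤ) % d), 3 * ((2 * (-(c : ℤ)) - d) % (2 * d))} : Finset ℤ),
        (6 * d : ℤ) ≤ 6 * ∑ u ∈ L, (u - 1) * c % d + (12 - L.card) * x) :=
  ⟨fun ⟨a, b, c, d, e, f, g, h, i⟩ => ⟨a, b, c, d, e, f, g, h, i⟩,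
    fun ⟨a, b, c, d, e, f, g, h, i⟩ => ⟨a, b, c, d, e, f, g, h, i⟩⟩

instance (d : ℕ) (L : Finset ℤ) : Decidable (AdmissibleUnits d L) :=
  decidable_of_iff' _ (admissibleUnits_iff d L)

/-- The integers `1, g, …, g ^ (k - 1)`. -/
def powers (g : ℤ) (k : ℕ) : Finset ℤ := (Finset.range k).image (g ^ ·)

/-- For 3, 4 and 6 the unit `-1` is available as these orders divide 12. For 7 and 14 only squares
are certain to preserve `w`. For the remaining orders a generator is known up to sign, so all signs
are checked. -/
theorem admissible_3 : AdmissibleUnits 3 {1, -1} := by decide +kernel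
theorem admissible_4 : AdmissibleUnits 4 {1, -1} := by decide +kernel
theorem admissible_6 : AdmissibleUnits 6 {1, -1} := by decide +kernel
theorem admissible_7 : AdmissibleUnits 7 (powers (3 * 3) 3) := by decide +kernel
theorem admissible_14 : AdmissibleUnits 14 (powers (3 * 3) 3) := by decide +kernel
theorem admissible_15 : ∀ g ∈ ({2, -2} : Finset ℤ), AdmissibleUnits 15 (powers g 4) := by
  decide +kernel
theorem admissible_20 : ∀ g ∈ ({3, -3} : Finset ℤ), AdmissibleUnits 20 (powers g 4) := by
  decide +kernel
theorem admissible_30 : ∀ g ∈ ({7, -7} : Finset ℤ), AdmissibleUnits 30 (powers g 4) := by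
  decide +kernel
theorem admissible_24 : ∀ g ∈ ({5, -5} : Finset ℤ), ∀ g' ∈ ({7, -7} : Finset ℤ),
    AdmissibleUnits 24 {1, g, g', g * g'} := by
  decide +kernel

section Arithmetic

variable {N : ℕ}

theorem mulInvariant_powers {w : ZMod N → ℕ} {d : ℕ} {g : ℤ} (hg : MulInvariant w d g) (k : ℕ) :
    ∀ u ∈ powers g k, MulInvariant w d u := by
  intro u hu
  obtain ⟨i, -, rfl⟩ := Finset.mem_image.1 hu
  exact hg.pow i

/-- The symmetry of the multiplicities of the eigenvalues of an automorphism of a lattice over an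
imaginary quadratic field of discriminant less than `-8`, or equal to `-7`. -/
structure IsQuadraticInvariant (w : ZMod N → ℕ) : Prop where
  mul_or_neg : ∀ (d : ℕ) (u : ℤ), 0 < d → IsCoprime u d → MulInvariant w d u ∨ MulInvariant w d (-u)
  neg_eight : MulInvariant w 8 (-1)
  neg_twelve : MulInvariant w 12 (-1)

theorem IsQuadraticInvariant.exists_sign {w : ZMod N → ℕ} (hw : IsQuadraticInvariant w) (d : ℕ)
    (u : ℤ) (hd : 0 < d) (hu : Int.gcd u d = 1) :
    ∃ g ∈ ({u, -u} : Finset ℤ), MulInvariant w d g := by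
  rcases hw.mul_or_neg d u hd (Int.isCoprime_iff_gcd_eq_one.2 hu) with h | h
  · exact ⟨u, by simp, h⟩
  · exact ⟨-u, by simp, h⟩

theorem IsQuadraticInvariant.mul_self {w : ZMod N → ℕ} (hw : IsQuadraticInvariant w) (d : ℕ)
    (u : ℤ) (hd : 0 < d) (hu : Int.gcd u d = 1) : MulInvariant w d (u * u) := by
  rcases hw.mul_or_neg d u hd (Int.isCoprime_iff_gcd_eq_one.2 hu) with h | h
  · exact h.mul h
  · simpa using h.mul h

theorem MulInvariant.forall_pair {w : ZMod N → ℕ} {d : ℕ} {u v : ℤ} (hu : MulInvariant w d u)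
    (hv : MulInvariant w d v) : ∀ x ∈ ({u, v} : Finset ℤ), MulInvariant w d x := by
  intro x hx
  rcases Finset.mem_insert.1 hx with rfl | hx
  · exact hu
  · rwa [Finset.mem_singleton.1 hx]

theorem IsQuadraticInvariant.exists_admissibleUnits {w : ZMod N → ℕ}
    (hw : IsQuadraticInvariant w) {d : ℕ} (hd : d ∈ exceptionalOrders) :
    ∃ L : Finset ℤ, AdmissibleUnits d L ∧ ∀ u ∈ L, MulInvariant w d u := by
  simp only [exceptionalOrders, Finset.mem_insert, Finset.mem_singleton] at hd
  rcases hd with rfl | rfl | rfl | rfl | rfl | rfl | rfl | rfl | rfl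
  · exact ⟨_, admissible_3, (MulInvariant.one w 3).forall_pair (hw.neg_twelve.mono (by norm_num))⟩
  · exact ⟨_, admissible_4, (MulInvariant.one w 4).forall_pair (hw.neg_twelve.mono (by norm_num))⟩
  · exact ⟨_, admissible_6, (MulInvariant.one w 6).forall_pair (hw.neg_twelve.mono (by norm_num))⟩
  · exact ⟨_, admissible_7, mulInvariant_powers (hw.mul_self 7 3 (by norm_num) (by decide)) 3⟩
  · exact ⟨_, admissible_14, mulInvariant_powers (hw.mul_self 14 3 (by norm_num) (by decide)) 3⟩
  · obtain ⟨g, hg, hi⟩ := hw.exists_sign 15 2 (by norm_num) (by decide)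
    exact ⟨_, admissible_15 g hg, mulInvariant_powers hi 4⟩
  · obtain ⟨g, hg, hi⟩ := hw.exists_sign 20 3 (by norm_num) (by decide)
    exact ⟨_, admissible_20 g hg, mulInvariant_powers hi 4⟩
  · obtain ⟨g, hg, hi⟩ := hw.exists_sign 24 5 (by norm_num) (by decide)
    obtain ⟨g', hg', hi'⟩ := hw.exists_sign 24 7 (by norm_num) (by decide)
    refine ⟨_, admissible_24 g hg g' hg', fun u hu => ?_⟩
    simp only [Finset.mem_insert, Finset.mem_singleton] at hu
    rcases hu with rfl | rfl | rfl | rfl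
    exacts [MulInvariant.one w 24, hi, hi', hi.mul hi']
  · obtain ⟨g, hg, hi⟩ := hw.exists_sign 30 7 (by norm_num) (by decide)
    exact ⟨_, admissible_30 g hg, mulInvariant_powers hi 4⟩

/-- A set of integers, distinct modulo `d`, whose orbits have Reid-Tai sum at least `1`. -/
def LargeOrbits (d : ℕ) (L : Finset ℤ) : Prop :=
  L.Nonempty ∧ (∀ u ∈ L, ∀ v ∈ L, (d : ℤ) ∣ v - u → u = v) ∧
    ∀ c ∈ Finset.range d, c.Coprime d → ∀ u₀ ∈ L, (d : ℤ) ≤ ∑ u ∈ L, (u - u₀) * c % d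

instance (d : ℕ) (L : Finset ℤ) : Decidable (LargeOrbits d L) := by
  unfold LargeOrbits; infer_instance

theorem largeOrbits_5 : ∀ g ∈ ({2, -2} : Finset ℤ), LargeOrbits 5 (powers g 4) := by
  decide +kernel
theorem largeOrbits_10 : ∀ g ∈ ({3, -3} : Finset ℤ), LargeOrbits 10 (powers g 4) := by
  decide +kernel
theorem largeOrbits_16 : ∀ g ∈ ({3, -3} : Finset ℤ), LargeOrbits 16 (powers g 4) := by
  decide +kernel
theorem largeOrbits_8 : ∀ g ∈ ({3, -3} : Finset ℤ), LargeOrbits 8 {1, -1, g, -1 * g} := by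
  decide +kernel
theorem largeOrbits_12 : ∀ g ∈ ({5, -5} : Finset ℤ), LargeOrbits 12 {1, -1, g, -1 * g} := by
  decide +kernel
theorem largeOrbits_9 : LargeOrbits 9 (powers (2 * 2) 3) := by decide +kernel
theorem largeOrbits_18 : LargeOrbits 18 (powers (5 * 5) 3) := by decide +kernel
theorem largeOrbits_11 : LargeOrbits 11 (powers (2 * 2) 5) := by decide +kernel
theorem largeOrbits_22 : LargeOrbits 22 (powers (7 * 7) 5) := by decide +kernel

theorem IsQuadraticInvariant.exists_largeOrbits {w : ZMod N → ℕ}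
    (hw : IsQuadraticInvariant w) {d : ℕ} (hd : d ∈ smallOrders) (hd' : d ∉ exceptionalOrders)
    (h1 : d ≠ 1) (h2 : d ≠ 2) :
    ∃ L : Finset ℤ, LargeOrbits d L ∧ ∀ u ∈ L, MulInvariant w d u := by
  have hd : d ∈ ({5, 8, 9, 10, 11, 12, 16, 18, 22} : Finset ℕ) := by
    simp only [smallOrders, exceptionalOrders, Finset.mem_insert, Finset.mem_singleton] at *
    omega
  have four : ∀ {d : ℕ} {g : ℤ}, MulInvariant w d (-1) → MulInvariant w d g →
      ∀ u ∈ ({1, -1, g, -1 * g} : Finset ℤ), MulInvariant w d u := by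
    intro d g h h' u hu
    simp only [Finset.mem_insert, Finset.mem_singleton] at hu
    rcases hu with rfl | rfl | rfl | rfl
    exacts [MulInvariant.one w d, h, h', h.mul h']
  simp only [Finset.mem_insert, Finset.mem_singleton] at hd
  rcases hd with rfl | rfl | rfl | rfl | rfl | rfl | rfl | rfl | rfl
  · obtain ⟨g, hg, hi⟩ := hw.exists_sign 5 2 (by norm_num) (by decide)
    exact ⟨_, largeOrbits_5 g hg, mulInvariant_powers hi 4⟩
  · obtain ⟨g, hg, hi⟩ := hw.exists_sign 8 3 (by norm_num) (by decide)
    exact ⟨_, largeOrbits_8 g hg, four hw.neg_eight hi⟩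
  · exact ⟨_, largeOrbits_9, mulInvariant_powers (hw.mul_self 9 2 (by norm_num) (by decide)) 3⟩
  · obtain ⟨g, hg, hi⟩ := hw.exists_sign 10 3 (by norm_num) (by decide)
    exact ⟨_, largeOrbits_10 g hg, mulInvariant_powers hi 4⟩
  · exact ⟨_, largeOrbits_11, mulInvariant_powers (hw.mul_self 11 2 (by norm_num) (by decide)) 5⟩
  · obtain ⟨g, hg, hi⟩ := hw.exists_sign 12 5 (by norm_num) (by decide)
    exact ⟨_, largeOrbits_12 g hg, four hw.neg_twelve hi⟩
  · obtain ⟨g, hg, hi⟩ := hw.exists_sign 16 3 (by norm_num) (by decide)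
    exact ⟨_, largeOrbits_16 g hg, mulInvariant_powers hi 4⟩
  · exact ⟨_, largeOrbits_18, mulInvariant_powers (hw.mul_self 18 5 (by norm_num) (by decide)) 3⟩
  · exact ⟨_, largeOrbits_22, mulInvariant_powers (hw.mul_self 22 7 (by norm_num) (by decide)) 5⟩

variable [NeZero N]

theorem IsQuadraticInvariant.le_sum_of_notMem_exceptionalOrders {w : ZMod N → ℕ}
    (hw : IsQuadraticInvariant w) (j : ZMod N) {b : ZMod N} (hb : 1 ≤ w b)
    (h1 : addOrderOf b ≠ 1) (h2 : addOrderOf b ≠ 2) (he : addOrderOf b ∉ exceptionalOrders) :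
    (N : ℤ) ≤ ∑ b, (w b : ℤ) * ((b - j).val : ℤ) := by
  have hpos : 0 < addOrderOf b := addOrderOf_pos b
  by_cases hs : addOrderOf b ∈ smallOrders
  · obtain ⟨L, ⟨hL, hdist, hB⟩, hinv⟩ := hw.exists_largeOrbits hs he h1 h2
    exact le_sum_of_orbit w j L hL hinv hdist hB rfl hb
  · have : NeZero (addOrderOf b) := ⟨hpos.ne'⟩
    obtain ⟨e, hN, A, hA, x₀, -, hle⟩ := exists_units_sum_le w j
      (fun u hu => hw.mul_or_neg _ u hpos hu) rfl hb
    refine le_trans ?_ hle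
    have := le_sum_of_notMem_smallOrders hs A hA x₀
    calc (N : ℤ) = e * (addOrderOf b : ℤ) := by
          conv_lhs => rw [hN]
          push_cast; ring
      _ ≤ _ := mul_le_mul_of_nonneg_left this (by positivity)

end Arithmetic

/-! ### The Reid–Tai inequality for weights on `ZMod N`. -/

section Arithmetic

variable {N : ℕ}

theorem addOrderOf_eq_one_or_two_iff {b : ZMod N} :
    addOrderOf b = 1 ∨ addOrderOf b = 2 ↔ 2 * b = 0 := by
  have h : 2 * b = 0 ↔ addOrderOf b ∣ 2 := by
    rw [addOrderOf_dvd_iff_nsmul_eq_zero, nsmul_eq_mul, Nat.cast_ofNat]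
  rw [h, Nat.dvd_prime Nat.prime_two]

theorem addOrderOf_mul_dvd (u b : ZMod N) : addOrderOf (u * b) ∣ addOrderOf b := by
  apply addOrderOf_dvd_of_nsmul_eq_zero
  rw [nsmul_eq_mul, mul_left_comm, natCast_addOrderOf_mul, mul_zero]

theorem addOrderOf_intCast_mul {d : ℕ} {u v : ℤ} (huv : (d : ℤ) ∣ v * u - 1) {b : ZMod N}
    (hb : addOrderOf b = d) : (v : ZMod N) * (u * b) = b ∧ addOrderOf ((u : ZMod N) * b) = d := by
  have h1 : (v : ZMod N) * (u * b) = b := by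
    obtain ⟨k, hk⟩ := huv
    have h2 := natCast_addOrderOf_mul b
    rw [hb] at h2
    have h3 : ((v * u : ℤ) : ZMod N) = ((d * k + 1 : ℤ) : ZMod N) := by
      congr 1; linarith
    push_cast at h3
    linear_combination b * h3 + (k : ZMod N) * h2
  refine ⟨h1, Nat.dvd_antisymm (hb ▸ addOrderOf_mul_dvd _ b) ?_⟩
  have := addOrderOf_mul_dvd (v : ZMod N) (u * b)
  rwa [h1, hb] at this

/-- Multiplication by a unit permutes the elements of order `d`, so a sum over them may be averaged
over `L`. -/
theorem card_mul_sum_eq [NeZero N] {d : ℕ} {L : Finset ℤ}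
    (hL : ∀ u ∈ L, ∃ x ∈ L, (d : ℤ) ∣ x * u - 1)
    (v : ZMod N → ℕ) (hv : ∀ u ∈ L, ∀ b, addOrderOf b = d → v (u * b) = v b) (f : ZMod N → ℤ) :
    (L.card : ℤ) * ∑ b with addOrderOf b = d, (v b : ℤ) * f b =
      ∑ b with addOrderOf b = d, (v b : ℤ) * ∑ u ∈ L, f (u * b) := by
  simp only [Finset.mul_sum (s := L)]
  rw [Finset.sum_comm, ← nsmul_eq_mul, ← Finset.sum_const]
  refine Finset.sum_congr rfl fun u hu => ?_
  obtain ⟨x, hx, hxu⟩ := hL u hu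
  symm
  refine Finset.sum_nbij (fun b => (u : ZMod N) * b) ?_ ?_ ?_ ?_
  · intro b hb
    simp only [Finset.mem_filter, Finset.mem_univ, true_and] at hb ⊢
    exact (addOrderOf_intCast_mul hxu hb).2
  · intro b hb b' hb' h
    simp only [Finset.coe_filter, Finset.mem_univ, true_and, Set.mem_ofPred_eq] at hb hb' h
    rw [← (addOrderOf_intCast_mul hxu hb).1, h, (addOrderOf_intCast_mul hxu hb').1]
  · intro b hb
    simp only [Finset.coe_filter, Finset.mem_univ, true_and, Set.mem_ofPred_eq, Set.mem_image] at hb ⊢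
    have hux : (d : ℤ) ∣ u * x - 1 := by rwa [mul_comm]
    exact ⟨x * b, (addOrderOf_intCast_mul hux hb).2, (addOrderOf_intCast_mul hux hb).1⟩
  · intro b hb
    simp only [Finset.mem_filter, Finset.mem_univ, true_and] at hb
    rw [hv u hu b hb]

variable [NeZero N]

theorem two_mul_val_of_two_torsion {b : ZMod N} (h2 : 2 * b = 0) (hb : b ≠ 0) :
    2 * b.val = N := by
  have h1 : ((2 * b.val : ℕ) : ZMod N) = 0 := by
    push_cast
    rw [ZMod.natCast_zmod_val, h2]
  rw [ZMod.natCast_eq_zero_iff] at h1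
  obtain ⟨k, hk⟩ := h1
  have h3 : 0 < b.val := Nat.pos_of_ne_zero fun h => hb ((ZMod.val_eq_zero b).1 h)
  have h4 := ZMod.val_lt b
  have hk1 : k = 1 := by
    rcases Nat.lt_or_ge k 2 with hk2 | hk2
    · interval_cases k
      · omega
      · rfl
    · have := Nat.mul_le_mul_left N hk2
      omega
  rw [hk, hk1, mul_one]

theorem two_mul_val_sub_of_two_torsion {b : ZMod N} (h2 : 2 * b = 0) (hb : b ≠ 0) (y : ℤ) :
    2 * ((((y : ZMod N) - b).val : ℕ) : ℤ) = (2 * y - N) % (2 * N) := by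
  have h3 := two_mul_val_of_two_torsion h2 hb
  have h4 : (y : ZMod N) - b = ((y - (b.val : ℤ) : ℤ) : ZMod N) := by
    push_cast
    rw [ZMod.natCast_zmod_val]
  rw [h4, ZMod.val_intCast, ← Int.mul_emod_mul_of_pos _ _ (by norm_num : (0 : ℤ) < 2)]
  congr 1
  have : (2 * b.val : ℤ) = N := by exact_mod_cast h3
  linarith

theorem AdmissibleUnits.le_sum {d : ℕ} {L : Finset ℤ} (hL : AdmissibleUnits d L)
    (v : ZMod N → ℕ) (hv : ∀ u ∈ L, ∀ b, addOrderOf b = d → v (u * b) = v b) (j : ZMod N) :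
    (N : ℤ) * ∑ b with addOrderOf b = d, (v b : ℤ) ≤
      6 * ∑ b with addOrderOf b = d, (v b : ℤ) * ((b - j).val : ℤ) := by
  have hpos : (0 : ℤ) < L.card := by exact_mod_cast Finset.card_pos.2 ⟨1, hL.one_mem⟩
  have h1 := card_mul_sum_eq hL.inv_mem v hv (fun b => ((b - j).val : ℤ))
  refine le_of_mul_le_mul_left ?_ hpos
  rw [mul_left_comm (L.card : ℤ) 6, h1, Finset.mul_sum, Finset.mul_sum, Finset.mul_sum]
  refine Finset.sum_le_sum fun b hb => ?_
  simp only [Finset.mem_filter, Finset.mem_univ, true_and] at hb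
  obtain ⟨e, c, hd, hN, hcd, hc, rfl⟩ := exists_eq_of_addOrderOf hb
  have h2 := le_sum_val_of_orbit hN hcd hc L ⟨1, hL.one_mem⟩ _ hL.bound_any j
  have h3 : (L.card * d : ℤ) ≤ 6 * ((L.card * d + 5) / 6) := by omega
  have h4 : (L.card * N : ℤ) ≤
      6 * ∑ u ∈ L, (((u : ZMod N) * ((e * c : ℤ) : ZMod N) - j).val : ℤ) := by
    calc (L.card * N : ℤ) = e * (L.card * d) := by rw [hN]; push_cast; ring
      _ ≤ e * (6 * ((L.card * d + 5) / 6)) := mul_le_mul_of_nonneg_left h3 (by positivity)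
      _ = 6 * (e * ((L.card * d + 5) / 6)) := by ring
      _ ≤ _ := mul_le_mul_of_nonneg_left h2 (by norm_num)
  have h5 : (0 : ℤ) ≤ v ((e * c : ℤ) : ZMod N) := by positivity
  have := mul_le_mul_of_nonneg_left h4 h5
  linarith

theorem AdmissibleUnits.le_sum_of_two_torsion {d : ℕ} {L : Finset ℤ} (hL : AdmissibleUnits d L)
    (w : ZMod N → ℕ) (hinv : ∀ u ∈ L, MulInvariant w d u) {j b : ZMod N} (hj : 2 * j = 0)
    (hb : addOrderOf b = d) (hw : 1 ≤ w b) :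
    (N : ℤ) ≤ ∑ b, (w b : ℤ) * ((b - j).val : ℤ) := by
  have htor := natCast_addOrderOf_mul b
  rw [hb] at htor
  obtain ⟨e, c, hd, hN, hcd, hc, rfl⟩ := exists_eq_of_addOrderOf hb
  have h2 := sum_le_sum_mul_val w j L (fun u : ℤ => (u : ZMod N) * ((e * c : ℤ) : ZMod N))
    (fun u hu v hv h => hL.distinct u hu v hv (intCast_mul_inj hN hc u v h))
    (fun u hu => by rw [hinv u hu _ htor]; exact hw)
  refine le_trans ?_ h2
  have hNe : (N : ℤ) = e * d := by rw [hN]; push_cast; ring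
  have h3 : ∀ u : ℤ, (u : ZMod N) * ((e * c : ℤ) : ZMod N) = ((e * (u * c) : ℤ) : ZMod N) := by
    intro u; push_cast; ring
  rcases eq_or_ne j 0 with rfl | hj0
  · simp only [sub_zero, h3, val_intCast_mul hN]
    rw [← Finset.mul_sum, hNe]
    exact mul_le_mul_of_nonneg_left (hL.bound_zero c (Finset.mem_range.2 hcd) hc) (by positivity)
  · have he : (0 : ℤ) < e := by
      have : e ≠ 0 := by rintro rfl; exact NeZero.ne N (by simpa using hN)
      positivity
    have h4 : ∀ u : ℤ, 2 * ((((u : ZMod N) * ((e * c : ℤ) : ZMod N) - j).val : ℕ) : ℤ) =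
        e * ((2 * (u * c) - d) % (2 * d)) := by
      intro u
      rw [h3, two_mul_val_sub_of_two_torsion hj hj0, ← Int.mul_emod_mul_of_pos _ _ he, hNe]
      congr 1 <;> ring
    have h5 : (2 * N : ℤ) ≤
        2 * ∑ u ∈ L, (((u : ZMod N) * ((e * c : ℤ) : ZMod N) - j).val : ℤ) := by
      rw [Finset.mul_sum]
      simp only [h4]
      rw [← Finset.mul_sum, hNe, mul_left_comm]
      exact mul_le_mul_of_nonneg_left (hL.bound_half c (Finset.mem_range.2 hcd) hc) (by positivity)
    linarith

theorem AdmissibleUnits.le_sum_self {d : ℕ} {L : Finset ℤ} (hL : AdmissibleUnits d L)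
    {j : ZMod N} (hj : addOrderOf j = d) {δ : ℤ}
    (hδ : δ = N ∨ ∃ b : ZMod N, 2 * b = 0 ∧ δ = 6 * ((b - j).val : ℤ)) :
    (6 * N : ℤ) ≤ 6 * ∑ u ∈ L, (((u : ZMod N) * j - j).val : ℤ) + (12 - L.card) * δ := by
  obtain ⟨e, c, hd, hN, hcd, hc, rfl⟩ := exists_eq_of_addOrderOf hj
  have hNe : (N : ℤ) = e * d := by rw [hN]; push_cast; ring
  have he : (0 : ℤ) < e := by
    have : e ≠ 0 := by rintro rfl; exact NeZero.ne N (by simpa using hN)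
    positivity
  have h3 : ∀ u : ℤ, (u : ZMod N) * ((e * c : ℤ) : ZMod N) - ((e * c : ℤ) : ZMod N) =
      ((e * ((u - 1) * c) : ℤ) : ZMod N) := by
    intro u; push_cast; ring
  simp only [h3, val_intCast_mul hN]
  obtain ⟨x, hx, hδx⟩ : ∃ x ∈ ({(d : ℤ), 6 * (-(c : ℤ) % d),
      3 * ((2 * (-(c : ℤ)) - d) % (2 * d))} : Finset ℤ), δ = e * x := by
    rcases hδ with rfl | ⟨b, hb, rfl⟩
    · exact ⟨d, by simp, hNe⟩
    have hneg : b - ((e * c : ℤ) : ZMod N) = ((e * -(c : ℤ) : ℤ) : ZMod N) - b := by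
      push_cast; linear_combination hb
    rcases eq_or_ne b 0 with rfl | hb0
    · refine ⟨6 * (-(c : ℤ) % d), by simp, ?_⟩
      rw [hneg, sub_zero, val_intCast_mul hN]; ring
    · refine ⟨3 * ((2 * (-(c : ℤ)) - d) % (2 * d)), by simp, ?_⟩
      have h4 := two_mul_val_sub_of_two_torsion hb hb0 (e * -(c : ℤ))
      rw [hneg]
      have h5 : (2 * (e * -(c : ℤ)) - N) % (2 * N) = e * ((2 * (-(c : ℤ)) - d) % (2 * d)) := by
        rw [← Int.mul_emod_mul_of_pos _ _ he, hNe]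
        congr 1 <;> ring
      rw [h5] at h4
      linarith
  have := mul_le_mul_of_nonneg_left (hL.bound_self c (Finset.mem_range.2 hcd) hc x hx) he.le
  rw [← Finset.mul_sum, hδx, hNe]
  linarith

/-- The number `δ / 6` serves as a common lower bound for the contributions of the eigenvalues
outside the orbit of `j`: `N / 6` on average for exceptional orders, the exact distance for `±1`. -/
theorem exists_min_two_torsion (j : ZMod N) : ∃ δ : ℤ, 0 ≤ δ ∧
    (δ = N ∨ ∃ b : ZMod N, 2 * b = 0 ∧ δ = 6 * ((b - j).val : ℤ)) ∧ δ ≤ N ∧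
      ∀ b : ZMod N, 2 * b = 0 → δ ≤ 6 * ((b - j).val : ℤ) := by
  classical
  let S : Finset ℤ := insert (N : ℤ) ((Finset.univ.filter fun b : ZMod N => 2 * b = 0).image
    fun b => 6 * ((b - j).val : ℤ))
  have hS : S.Nonempty := Finset.insert_nonempty _ _
  have hmem : ∀ x, x ∈ S ↔ x = N ∨ ∃ b : ZMod N, 2 * b = 0 ∧ x = 6 * ((b - j).val : ℤ) := by
    intro x
    simp [S, eq_comm]
  refine ⟨S.min' hS, ?_, (hmem _).1 (S.min'_mem hS), S.min'_le _ ((hmem _).2 (Or.inl rfl)),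
    fun b hb => S.min'_le _ ((hmem _).2 (Or.inr ⟨b, hb, rfl⟩))⟩
  rcases (hmem _).1 (S.min'_mem hS) with h | ⟨b, -, h⟩ <;> rw [h] <;> positivity

/-- The Reid-Tai inequality for functions on `ZMod N` having the symmetry of the multiplicities of
the eigenvalues of an automorphism of a lattice over an imaginary quadratic field. -/
theorem IsQuadraticInvariant.le_sum {w : ZMod N → ℕ} (hw : IsQuadraticInvariant w)
    (hsum : 12 ≤ ∑ b, w b) (j : ZMod N) (hj : 1 ≤ w j) (hj2 : w j + 2 ≤ ∑ b, w b) :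
    (N : ℤ) ≤ ∑ b, (w b : ℤ) * ((b - j).val : ℤ) := by
  classical
  -- One orbit of such an order settles the claim, whatever `j` is.
  by_cases hgood : ∃ b, 1 ≤ w b ∧ 2 * b ≠ 0 ∧ addOrderOf b ∉ exceptionalOrders
  · obtain ⟨b, hb, h2, he⟩ := hgood
    rw [Ne, ← addOrderOf_eq_one_or_two_iff, not_or] at h2
    exact hw.le_sum_of_notMem_exceptionalOrders j hb h2.1 h2.2 he
  push Not at hgood
  by_cases htor : 2 * j = 0
  · by_cases hexc : ∃ b, 1 ≤ w b ∧ addOrderOf b ∈ exceptionalOrders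
    · obtain ⟨b, hb, he⟩ := hexc
      obtain ⟨L, hL, hinv⟩ := hw.exists_admissibleUnits he
      exact hL.le_sum_of_two_torsion w hinv htor rfl hb
    push Not at hexc
    have hsup : ∀ b, 1 ≤ w b → 2 * b = 0 := fun b hb => by
      by_contra h
      exact hexc b hb (hgood b hb h)
    have h1 : ∀ b ∈ Finset.univ.erase j,
        (w b : ℤ) * N = 2 * ((w b : ℤ) * ((b - j).val : ℤ)) := by
      intro b hb
      rcases Nat.eq_zero_or_pos (w b) with h0 | h0
      · rw [h0]; simp
      have h2 := two_mul_val_of_two_torsion (b := b - j)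
        (by rw [mul_sub, hsup b h0, htor, sub_zero]) (sub_ne_zero.2 (Finset.ne_of_mem_erase hb))
      have : (2 * (b - j).val : ℤ) = N := by exact_mod_cast h2
      rw [← this]; ring
    have h2 := Finset.add_sum_erase Finset.univ (fun b => (w b : ℤ) * ((b - j).val : ℤ))
      (Finset.mem_univ j)
    have h3 := Finset.add_sum_erase Finset.univ w (Finset.mem_univ j)
    -- All eigenvalues are now `±1`; those different from the base one lie at distance exactly `N /
    -- 2`, so two of them are enough.
    have h4 : (2 : ℤ) ≤ ∑ b ∈ Finset.univ.erase j, (w b : ℤ) := by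
      have : 2 ≤ ∑ b ∈ Finset.univ.erase j, w b := by omega
      exact_mod_cast this
    have h5 := Finset.sum_congr rfl h1
    rw [← Finset.sum_mul, ← Finset.mul_sum] at h5
    simp only [sub_self, ZMod.val_zero, Nat.cast_zero, mul_zero, zero_add] at h2
    rw [← h2]
    nlinarith
  have hexcj := hgood j hj htor
  have hchoice : ∀ d : ℕ, ∃ L : Finset ℤ, d ∈ exceptionalOrders →
      AdmissibleUnits d L ∧ ∀ u ∈ L, MulInvariant w d u := by
    intro d
    by_cases hd : d ∈ exceptionalOrders
    · obtain ⟨L, h⟩ := hw.exists_admissibleUnits hd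
      exact ⟨L, fun _ => h⟩
    · exact ⟨∅, fun h => absurd h hd⟩
  choose L hL using hchoice
  obtain ⟨δ, hδ0, hδ, hδN, hδtor⟩ := exists_min_two_torsion j
  obtain ⟨hLj, hinvj⟩ := hL _ hexcj
  set d := addOrderOf j with hd
  have htorj : (d : ZMod N) * j = 0 := natCast_addOrderOf_mul j
  have h1 := hLj.le_sum_self hd.symm hδ
  let O : Finset (ZMod N) := (L d).image fun u : ℤ => (u : ZMod N) * j
  have hinjO : Set.InjOn (fun u : ℤ => (u : ZMod N) * j) (L d) := by
    intro u hu v hv huv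
    obtain ⟨e, c, -, hN, hcd, hc, hje⟩ := exists_eq_of_addOrderOf hd.symm
    rw [hje] at huv
    exact hLj.distinct u hu v hv (intCast_mul_inj hN hc u v huv)
  have hcardO : O.card = (L d).card := Finset.card_image_of_injOn hinjO
  have hordO : ∀ b ∈ O, addOrderOf b = d := by
    intro b hb
    obtain ⟨u, hu, rfl⟩ := Finset.mem_image.1 hb
    obtain ⟨x, hx, hxu⟩ := hLj.inv_mem u hu
    exact (addOrderOf_intCast_mul hxu hd.symm).2
  have hmulO : ∀ u ∈ L d, ∀ b ∈ O, (u : ZMod N) * b ∈ O := by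
    intro u hu b hb
    obtain ⟨v, hv, rfl⟩ := Finset.mem_image.1 hb
    obtain ⟨x, hx, k, hk⟩ := hLj.mul_mem u hu v hv
    refine Finset.mem_image.2 ⟨x, hx, ?_⟩
    have : (x : ZMod N) = ((d * k + u * v : ℤ) : ZMod N) := by congr 1; linarith
    simp only [this]
    push_cast
    linear_combination (k : ZMod N) * htorj
  have hwO : ∀ b ∈ O, 1 ≤ w b := by
    intro b hb
    obtain ⟨u, hu, rfl⟩ := Finset.mem_image.1 hb
    rw [hinvj u hu j htorj]
    exact hj
  -- One copy of the orbit of `j` is set aside and counted exactly by `le_sum_self`. The remainder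
  -- `v` keeps the symmetry because `O` is stable under the units in `L d`.
  let v : ZMod N → ℕ := fun b => w b - if b ∈ O then 1 else 0
  have hwv : ∀ b, w b = v b + if b ∈ O then 1 else 0 := by
    intro b
    simp only [v]
    split_ifs with h
    · have := hwO b h
      omega
    · omega
  have hv : ∀ d' ∈ exceptionalOrders, ∀ u ∈ L d', ∀ b, addOrderOf b = d' → v (u * b) = v b := by
    intro d' hd' u hu b hb
    obtain ⟨hLd, hinvd⟩ := hL d' hd'
    obtain ⟨x, hx, hxu⟩ := hLd.inv_mem u hu
    obtain ⟨hxub, hub⟩ := addOrderOf_intCast_mul hxu hb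
    have htorb := natCast_addOrderOf_mul b
    rw [hb] at htorb
    have hiff : (u : ZMod N) * b ∈ O ↔ b ∈ O := by
      constructor
      · intro h
        obtain rfl : d' = d := by rw [← hub, hordO _ h]
        rw [← hxub]
        exact hmulO x hx _ h
      · intro h
        obtain rfl : d' = d := by rw [← hb, hordO _ h]
        exact hmulO u hu _ h
    simp only [v, hinvd u hu b htorb, hiff]
  have hfib : ∀ d' ∈ Finset.univ.image (addOrderOf (G := ZMod N)),
      δ * ∑ b with addOrderOf b = d', (v b : ℤ) ≤
        6 * ∑ b with addOrderOf b = d', (v b : ℤ) * ((b - j).val : ℤ) := by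
    intro d' _
    by_cases hd' : d' ∈ exceptionalOrders
    · refine le_trans ?_ ((hL d' hd').1.le_sum v (hv d' hd') j)
      exact mul_le_mul_of_nonneg_right hδN (Finset.sum_nonneg fun b _ => by positivity)
    · rw [Finset.mul_sum, Finset.mul_sum]
      refine Finset.sum_le_sum fun b hb => ?_
      simp only [Finset.mem_filter, Finset.mem_univ, true_and] at hb
      by_cases h2 : 2 * b = 0
      · have := mul_le_mul_of_nonneg_left (hδtor b h2) (by positivity : (0 : ℤ) ≤ v b)
        linarith
      · have h0 : v b = 0 := by
          by_contra h0
          have : 1 ≤ w b := by rw [hwv]; omega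
          exact hd' (hb ▸ hgood b this h2)
        rw [h0]; simp
  have hsumv := Finset.sum_le_sum hfib
  rw [← Finset.mul_sum, ← Finset.mul_sum, Finset.sum_fiberwise_of_maps_to
    (fun b _ => Finset.mem_image_of_mem _ (Finset.mem_univ b)), Finset.sum_fiberwise_of_maps_to
    (fun b _ => Finset.mem_image_of_mem _ (Finset.mem_univ b))] at hsumv
  have htot : (∑ b, (w b : ℤ)) = ∑ b, (v b : ℤ) + (L d).card := by
    rw [← hcardO]
    simp only [hwv, Nat.cast_add, Finset.sum_add_distrib, Nat.cast_ite, Nat.cast_one,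
      Nat.cast_zero]
    simp
  have hT : (∑ b, (w b : ℤ) * ((b - j).val : ℤ)) = ∑ b, (v b : ℤ) * ((b - j).val : ℤ) +
      ∑ u ∈ L d, (((u : ZMod N) * j - j).val : ℤ) := by
    rw [← Finset.sum_image (g := fun u : ℤ => (u : ZMod N) * j)
      (f := fun b : ZMod N => ((b - j).val : ℤ)) hinjO]
    simp only [hwv, Nat.cast_add, add_mul, Finset.sum_add_distrib, Nat.cast_ite, Nat.cast_one,
      Nat.cast_zero, ite_mul, one_mul, zero_mul]
    rw [← Finset.sum_filter]
    simp
    rfl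
  have hsumw : (12 : ℤ) ≤ ∑ b, (w b : ℤ) := by exact_mod_cast hsum
  -- The total weight is at least 12, so at least `12 - (L d).card` of it remains outside the orbit.
  have hfin : (12 - (L d).card : ℤ) * δ ≤ δ * ∑ b, (v b : ℤ) := by
    rw [mul_comm δ]
    exact mul_le_mul_of_nonneg_right (by linarith) hδ0
  rw [hT]
  linarith

end Arithmetic

/-! ### Galois symmetry of the eigenvalue multiplicities. -/

section Galois

/-- The field of algebraic numbers in `ℂ`. -/
noncomputable abbrev QBar : IntermediateField ℚ ℂ := algebraicClosure ℚ ℂ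

/-- The square root of `D` in `ℂ` that generates `ImagQuad D`. -/
noncomputable def sqrtC (D : ℤ) : ℂ := Complex.I * (Real.sqrt (-(D : ℝ)) : ℂ)

theorem sqrtC_sq {D : ℤ} (hD : D < 0) : sqrtC D ^ 2 = D := by
  have h : (0 : ℝ) ≤ -(D : ℝ) := by
    have : (D : ℝ) < 0 := by exact_mod_cast hD
    linarith
  rw [sqrtC, mul_pow, Complex.I_sq, ← Complex.ofReal_pow, Real.sq_sqrt h]
  push_cast
  ring

theorem conj_sqrtC (D : ℤ) : conj (sqrtC D) = -sqrtC D := by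
  simp [sqrtC]

theorem sqrtC_mem_qBar {D : ℤ} (hD : D < 0) : sqrtC D ∈ QBar := by
  rw [mem_algebraicClosure_iff']
  refine IsIntegral.of_pow (n := 2) (by norm_num) ?_
  rw [sqrtC_sq hD]
  exact isIntegral_algebraMap (R := ℚ) (A := ℂ) (x := (D : ℚ)) |> fun h => by simpa using h

theorem rootOfUnity_mem_qBar {x : ℂ} {d : ℕ} (hd : 0 < d) (hx : x ^ d = 1) : x ∈ QBar := by
  rw [mem_algebraicClosure_iff']
  refine IsIntegral.of_pow hd ?_
  rw [hx]
  exact isIntegral_one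

instance : IsAlgClosure ℚ QBar := algebraicClosure.isAlgClosure ℚ ℂ

instance : Normal ℚ QBar := IsAlgClosure.normal ℚ QBar

/-- Complex conjugation on the algebraic numbers. -/
noncomputable def conjQBar : Gal(QBar/ℚ) := (Complex.conjAe.restrictScalars ℚ).restrictNormal QBar

theorem coe_conjQBar (x : QBar) : ((conjQBar x : QBar) : ℂ) = conj (x : ℂ) :=
  AlgEquiv.restrictNormal_commutes (Complex.conjAe.restrictScalars ℚ) QBar x

theorem conjQBar_rootOfUnity {x : QBar} {d : ℕ} (hd : 0 < d) (hx : x ^ d = 1) :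
    conjQBar x = x⁻¹ := by
  apply Subtype.ext
  have h1 : (x : ℂ) ^ d = 1 := by exact_mod_cast congrArg Subtype.val hx
  rw [coe_conjQBar, IntermediateField.coe_inv,
    Complex.inv_eq_conj (Complex.norm_eq_one_of_pow_eq_one h1 hd.ne')]

theorem exists_primitiveRoot_qBar {d : ℕ} (hd : 0 < d) : ∃ z : QBar, IsPrimitiveRoot z d := by
  have h1 := Complex.isPrimitiveRoot_exp d hd.ne'
  exact ⟨⟨_, rootOfUnity_mem_qBar hd h1.pow_eq_one⟩, IsPrimitiveRoot.of_map_of_injective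
    (f := algebraMap QBar ℂ) h1 (algebraMap QBar ℂ).injective⟩

/-- A primitive root `z` and its power `z ^ u` share the cyclotomic polynomial as minimal
polynomial, hence are conjugate. -/
theorem exists_gal_pow {d : ℕ} (hd : 0 < d) {u : ℤ} (hu : IsCoprime u d) :
    ∃ σ : Gal(QBar/ℚ), ∀ x : QBar, x ^ d = 1 → σ x = x ^ u := by
  obtain ⟨z, hz⟩ := exists_primitiveRoot_qBar hd
  have hz' : IsPrimitiveRoot (z ^ u) d := hz.zpow_of_gcd_eq_one u (Int.isCoprime_iff_gcd_eq_one.1 hu)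
  have hmin : minpoly ℚ (z ^ u) = minpoly ℚ z := by
    rw [← Polynomial.cyclotomic_eq_minpoly_rat hz hd, ← Polynomial.cyclotomic_eq_minpoly_rat hz' hd]
  obtain ⟨σ, hσ⟩ := (Normal.minpoly_eq_iff_mem_orbit (F := ℚ) QBar).1 hmin
  refine ⟨σ, fun x hx => ?_⟩
  have : NeZero d := ⟨hd.ne'⟩
  obtain ⟨i, -, rfl⟩ := hz.eq_pow_of_pow_eq_one hx
  have h2 : σ z = z ^ u := hσ
  rw [map_pow, h2, ← zpow_natCast, ← zpow_natCast, ← zpow_mul, ← zpow_mul, mul_comm]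

variable {D : ℤ}

/-- `√D` as an algebraic number. -/
noncomputable def sqrtQBar (hD : D < 0) : QBar := ⟨sqrtC D, sqrtC_mem_qBar hD⟩

theorem sqrtQBar_sq (hD : D < 0) : sqrtQBar hD ^ 2 = D := by
  apply Subtype.ext
  push_cast
  exact sqrtC_sq hD

theorem conjQBar_sqrtQBar (hD : D < 0) : conjQBar (sqrtQBar hD) = -sqrtQBar hD := by
  apply Subtype.ext
  rw [coe_conjQBar]
  exact conj_sqrtC D

theorem gal_sqrtQBar (hD : D < 0) (σ : Gal(QBar/ℚ)) :
    σ (sqrtQBar hD) = sqrtQBar hD ∨ σ (sqrtQBar hD) = -sqrtQBar hD := by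
  apply sq_eq_sq_iff_eq_or_eq_neg.1
  rw [← map_pow, sqrtQBar_sq, map_intCast]

/-- If the automorphism raising to the power `u` negates `√D`, composing it with complex conjugation
repairs this at the price of `u ↦ -u`. -/
theorem exists_gal_pow_or_neg (hD : D < 0) {d : ℕ} (hd : 0 < d) {u : ℤ} (hu : IsCoprime u d) :
    ∃ σ : Gal(QBar/ℚ), σ (sqrtQBar hD) = sqrtQBar hD ∧
      ((∀ x : QBar, x ^ d = 1 → σ x = x ^ u) ∨ (∀ x : QBar, x ^ d = 1 → σ x = x ^ (-u))) := by
  obtain ⟨σ, hσ⟩ := exists_gal_pow hd hu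
  rcases gal_sqrtQBar hD σ with h | h
  · exact ⟨σ, h, Or.inl hσ⟩
  · refine ⟨σ * conjQBar, ?_, Or.inr fun x hx => ?_⟩
    · rw [AlgEquiv.mul_apply, conjQBar_sqrtQBar, map_neg, h, neg_neg]
    · rw [AlgEquiv.mul_apply, conjQBar_rootOfUnity hd hx, map_inv₀, hσ x hx, zpow_neg]

/-- If `-(k * D)` were a square then `-D` would be `k` times a square, and squarefreeness would
leave `-D = k ≤ 3`. -/
theorem not_isSquare_neg_mul (hsq : Squarefree D) (hD : D < -3) {k : ℕ} (hk : k.Prime ∨ k = 1)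
    (hk3 : k ≤ 3) (r : ℚ) : r ^ 2 ≠ -(k * D) := by
  intro hr
  have h1 : IsSquare ((-(k * D) : ℤ) : ℚ) := ⟨r, by push_cast; rw [← hr, sq]⟩
  rw [Rat.isSquare_intCast_iff] at h1
  obtain ⟨m, hm⟩ := h1
  obtain ⟨m', hm'⟩ : (k : ℤ) ∣ m := by
    rcases hk with hk | rfl
    · have h2 : (k : ℤ) ∣ m * m := ⟨-D, by rw [← hm]; ring⟩
      rcases (Nat.prime_iff_prime_int.1 hk).dvd_mul.1 h2 with h | h <;> exact h
    · simp
  have hk0 : (k : ℤ) ≠ 0 := by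
    rcases hk with hk | rfl
    · exact_mod_cast hk.ne_zero
    · norm_num
  have h3 : -D = k * (m' * m') := by
    apply mul_left_cancel₀ hk0
    rw [hm'] at hm
    linarith
  have h4 : m' * m' ∣ D := ⟨-k, by linarith⟩
  have h5 := Int.isUnit_iff.1 (hsq m' h4)
  have h6 : m' * m' = 1 := by rcases h5 with h | h <;> rw [h] <;> norm_num
  rw [h6] at h3
  have : (k : ℤ) ≤ 3 := by exact_mod_cast hk3
  omega

/-- The situation of a biquadratic cyclotomic field `ℚ(z)` with imaginary quadratic elements `t =
√-1` and `q = √-k`. Were there no such `σ`, the stabiliser of `z` would fix `√D`, so `√D` would lie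
in `ℚ(z)`. According to whether `τ` fixes or negates it, `√D * t` or `√D * q` is then fixed by
everything, hence rational, which `not_isSquare_neg_mul` excludes. -/
theorem exists_gal_inv_of_quadratic (hsq : Squarefree D) (hD : D < -3) (hD0 : D < 0) {k : ℕ}
    (hk : k.Prime) (hk3 : k ≤ 3) {z t q : QBar} (hcz : conjQBar z = z⁻¹) (τ : Gal(QBar/ℚ))
    (hz : ∀ σ : Gal(QBar/ℚ), σ z = z ∨ σ z = z⁻¹ ∨ σ z = τ z ∨ σ z = (τ z)⁻¹)
    (ht : ∀ σ : Gal(QBar/ℚ), σ z = z → σ t = t) (hq : ∀ σ : Gal(QBar/ℚ), σ z = z → σ q = q)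
    (hct : conjQBar t = -t) (hcq : conjQBar q = -q) (hτt : τ t = t) (hτq : τ q = -q)
    (ht2 : t ^ 2 = -1) (hq2 : q ^ 2 = -k) :
    ∃ σ : Gal(QBar/ℚ), σ (sqrtQBar hD0) = sqrtQBar hD0 ∧ σ z = z⁻¹ := by
  by_contra! hno
  set s := sqrtQBar hD0 with hs
  have hstab : ∀ σ : Gal(QBar/ℚ), σ z = z → σ s = s := by
    intro σ hσ
    rcases gal_sqrtQBar hD0 σ with h | h
    · exact h
    · refine absurd ?_ (hno (σ * conjQBar) ?_)
      · rw [AlgEquiv.mul_apply, hcz, map_inv₀, hσ]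
      · rw [AlgEquiv.mul_apply, conjQBar_sqrtQBar, map_neg, h, neg_neg]
  have hrat : ∀ x : QBar, (∀ σ : Gal(QBar/ℚ), σ z = z → σ x = x) → conjQBar x = x → τ x = x →
      ∃ r : ℚ, (r : QBar) = x := by
    intro x h1 h2 h3
    have hfix : ∀ σ : Gal(QBar/ℚ), σ x = x := by
      have hc : ∀ σ : Gal(QBar/ℚ), σ z = z⁻¹ → σ x = x := by
        intro σ hσ
        have := h1 (σ * conjQBar) (by rw [AlgEquiv.mul_apply, hcz, map_inv₀, hσ, inv_inv])
        rwa [AlgEquiv.mul_apply, h2] at this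
      have hτ : ∀ σ : Gal(QBar/ℚ), (τ⁻¹ * σ) x = x → σ x = x := by
        intro σ h
        rw [AlgEquiv.mul_apply] at h
        have := congrArg τ h
        rwa [← AlgEquiv.mul_apply, mul_inv_cancel, AlgEquiv.one_apply, h3] at this
      have hτz : ∀ y : QBar, τ⁻¹ (τ y) = y := fun y => by
        rw [← AlgEquiv.mul_apply, inv_mul_cancel, AlgEquiv.one_apply]
      intro σ
      rcases hz σ with h | h | h | h
      · exact h1 σ h
      · exact hc σ h
      · exact hτ σ (h1 _ (by rw [AlgEquiv.mul_apply, h, hτz]))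
      · exact hτ σ (hc _ (by rw [AlgEquiv.mul_apply, h, map_inv₀, hτz]))
    obtain ⟨r, hr⟩ := (InfiniteGalois.mem_range_algebraMap_iff_fixed (k := ℚ) x).2 hfix
    exact ⟨r, hr⟩
  rcases gal_sqrtQBar hD0 τ with h | h
  · obtain ⟨r, hr⟩ := hrat (s * t) (fun σ hσ => by rw [map_mul, hstab σ hσ, ht σ hσ])
      (by rw [map_mul, conjQBar_sqrtQBar, hct, neg_mul_neg]) (by rw [map_mul, h, hτt])
    refine not_isSquare_neg_mul hsq hD (k := 1) (Or.inr rfl) (by norm_num) r ?_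
    have h2 : ((r ^ 2 : ℚ) : QBar) = ((-(1 * D) : ℚ) : QBar) := by
      push_cast
      rw [hr, mul_pow, sqrtQBar_sq, ht2]; ring
    simpa using (Rat.cast_injective h2 : r ^ 2 = -(1 * (D : ℚ)))
  · obtain ⟨r, hr⟩ := hrat (s * q) (fun σ hσ => by rw [map_mul, hstab σ hσ, hq σ hσ])
      (by rw [map_mul, conjQBar_sqrtQBar, hcq, neg_mul_neg])
      (by rw [map_mul, h, hτq, neg_mul_neg])
    refine not_isSquare_neg_mul hsq hD (k := k) (Or.inl hk) hk3 r ?_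
    have h2 : ((r ^ 2 : ℚ) : QBar) = ((-(k * D) : ℚ) : QBar) := by
      push_cast
      rw [hr, mul_pow, sqrtQBar_sq, hq2]; ring
    exact Rat.cast_injective h2

theorem gal_inv_of_primitiveRoot {d : ℕ} (hd : 0 < d) {z : QBar} (hz : IsPrimitiveRoot z d)
    {σ : Gal(QBar/ℚ)} (hσ : σ z = z⁻¹) : ∀ x : QBar, x ^ d = 1 → σ x = x ^ (-1 : ℤ) := by
  intro x hx
  have : NeZero d := ⟨hd.ne'⟩
  obtain ⟨i, -, rfl⟩ := hz.eq_pow_of_pow_eq_one hx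
  rw [map_pow, hσ, zpow_neg_one, inv_pow]

theorem exists_gal_inv_eight (hsq : Squarefree D) (hD : D < -3) (hD0 : D < 0) :
    ∃ σ : Gal(QBar/ℚ), σ (sqrtQBar hD0) = sqrtQBar hD0 ∧
      ∀ x : QBar, x ^ 8 = 1 → σ x = x ^ (-1 : ℤ) := by
  obtain ⟨z, hz⟩ := exists_primitiveRoot_qBar (d := 8) (by norm_num)
  obtain ⟨τ, hτ⟩ := exists_gal_pow (d := 8) (by norm_num) (u := 5) (by norm_num)
  have h8 : z ^ 8 = 1 := hz.pow_eq_one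
  have h4 : z ^ 4 = -1 := by
    have h : (z ^ 4 - 1) * (z ^ 4 + 1) = 0 := by ring_nf; rw [h8]; ring
    rcases mul_eq_zero.1 h with h | h
    · exact absurd (sub_eq_zero.1 h) (hz.pow_ne_one_of_pos_of_lt (by norm_num) (by norm_num))
    · exact eq_neg_of_add_eq_zero_left h
  have hz0 : z ≠ 0 := hz.ne_zero (by norm_num)
  have hinv : z⁻¹ = -z ^ 3 := by
    exact inv_eq_of_mul_eq_one_right (by linear_combination -h4)
  have hτz : τ z = -z := by
    rw [hτ z h8]
    norm_cast
    linear_combination z * h4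
  have hcz := conjQBar_rootOfUnity (d := 8) (by norm_num) h8
  have hσ : ∀ σ : Gal(QBar/ℚ), σ z = z ∨ σ z = z⁻¹ ∨ σ z = τ z ∨ σ z = (τ z)⁻¹ := by
    intro σ
    have h1 : IsPrimitiveRoot (σ z) 8 := hz.map_of_injective σ.injective
    obtain ⟨i, hi, hcop, hiz⟩ := hz.isPrimitiveRoot_iff.1 h1
    rw [← hiz, hτz, inv_neg, hinv]
    have hi' : i = 1 ∨ i = 3 ∨ i = 5 ∨ i = 7 := by
      clear hiz
      revert hcop
      interval_cases i <;> decide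
    rcases hi' with rfl | rfl | rfl | rfl
    · left; ring
    · right; right; right; ring
    · right; right; left; linear_combination z * h4
    · right; left; linear_combination z ^ 3 * h4
  -- Here `z ^ 2` is a square root of `-1` and `z + z ^ 3` a square root of `-2`.
  obtain ⟨σ, h1, h2⟩ := exists_gal_inv_of_quadratic hsq hD hD0 (k := 2) Nat.prime_two (by norm_num)
    (z := z) (t := z ^ 2) (q := z + z ^ 3) hcz τ hσ (fun σ h => by rw [map_pow, h])
    (fun σ h => by rw [map_add, map_pow, h])
    (by rw [map_pow, hcz, hinv]; linear_combination z ^ 2 * h4)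
    (by rw [map_add, map_pow, hcz, hinv]; linear_combination (-z ^ 5 + z) * h4)
    (by rw [map_pow, hτz]; ring) (by rw [map_add, map_pow, hτz]; ring)
    (by linear_combination h4) (by push_cast; linear_combination (z ^ 2 + 2) * h4)
  exact ⟨σ, h1, gal_inv_of_primitiveRoot (by norm_num) hz h2⟩

theorem exists_gal_inv_twelve (hsq : Squarefree D) (hD : D < -3) (hD0 : D < 0) :
    ∃ σ : Gal(QBar/ℚ), σ (sqrtQBar hD0) = sqrtQBar hD0 ∧
      ∀ x : QBar, x ^ 12 = 1 → σ x = x ^ (-1 : ℤ) := by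
  obtain ⟨z, hz⟩ := exists_primitiveRoot_qBar (d := 12) (by norm_num)
  obtain ⟨τ, hτ⟩ := exists_gal_pow (d := 12) (by norm_num) (u := 5) (by norm_num)
  have h12 : z ^ 12 = 1 := hz.pow_eq_one
  have h6 : z ^ 6 = -1 := by
    have h : (z ^ 6 - 1) * (z ^ 6 + 1) = 0 := by ring_nf; rw [h12]; ring
    rcases mul_eq_zero.1 h with h | h
    · exact absurd (sub_eq_zero.1 h) (hz.pow_ne_one_of_pos_of_lt (by norm_num) (by norm_num))
    · exact eq_neg_of_add_eq_zero_left h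
  have h4 : z ^ 4 - z ^ 2 + 1 = 0 := by
    have h : (z ^ 2 + 1) * (z ^ 4 - z ^ 2 + 1) = 0 := by linear_combination h6
    rcases mul_eq_zero.1 h with h | h
    · exact absurd (show z ^ 4 = 1 by linear_combination (z ^ 2 - 1) * h)
        (hz.pow_ne_one_of_pos_of_lt (by norm_num) (by norm_num))
    · exact h
  have hinv : z⁻¹ = -z ^ 5 := inv_eq_of_mul_eq_one_right (by linear_combination -h6)
  have hτz : τ z = z ^ 5 := by
    rw [hτ z h12]
    norm_cast
  have hcz := conjQBar_rootOfUnity (d := 12) (by norm_num) h12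
  have hσ : ∀ σ : Gal(QBar/ℚ), σ z = z ∨ σ z = z⁻¹ ∨ σ z = τ z ∨ σ z = (τ z)⁻¹ := by
    intro σ
    have h1 : IsPrimitiveRoot (σ z) 12 := hz.map_of_injective σ.injective
    obtain ⟨i, hi, hcop, hiz⟩ := hz.isPrimitiveRoot_iff.1 h1
    rw [← hiz, hτz, ← inv_pow, hinv]
    have hi' : i = 1 ∨ i = 5 ∨ i = 7 ∨ i = 11 := by
      clear hiz
      revert hcop
      interval_cases i <;> decide
    rcases hi' with rfl | rfl | rfl | rfl
    · left; ring
    · right; right; left; ring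
    · right; right; right; linear_combination z ^ 7 * (z ^ 12 - z ^ 6 + 1) * h6
    · right; left; linear_combination z ^ 5 * h6
  -- Here `z ^ 3` is a square root of `-1` and `z ^ 2 + z ^ 4` a square root of `-3`.
  obtain ⟨σ, h1, h2⟩ := exists_gal_inv_of_quadratic hsq hD hD0 (k := 3) Nat.prime_three le_rfl
    (z := z) (t := z ^ 3) (q := z ^ 2 + z ^ 4) hcz τ hσ (fun σ h => by rw [map_pow, h])
    (fun σ h => by rw [map_add, map_pow, map_pow, h])
    (by rw [map_pow, hcz, hinv]; linear_combination -z ^ 3 * h12)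
    (by
      rw [map_add, map_pow, map_pow, hcz, hinv]
      linear_combination (z ^ 4 + z ^ 2 * (z ^ 12 - z ^ 6 + 1)) * h6)
    (by rw [map_pow, hτz]; linear_combination z ^ 3 * h12)
    (by
      rw [map_add, map_pow, map_pow, hτz]
      linear_combination (z ^ 4 + z ^ 2 * (z ^ 12 - z ^ 6 + 1)) * h6)
    (by linear_combination h6) (by push_cast; linear_combination (z ^ 2 + 2) * h6 + h4)
  exact ⟨σ, h1, gal_inv_of_primitiveRoot (by norm_num) hz h2⟩

/-- The inclusion of `ℚ(√D)` in the algebraic numbers. -/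
noncomputable def imagQuadToQBar (hD : D < 0) : ImagQuad D →ₐ[ℚ] QBar :=
  IntermediateField.inclusion (by
    rw [IntermediateField.adjoin_le_iff, Set.singleton_subset_iff]
    exact sqrtC_mem_qBar hD)

theorem gal_imagQuadToQBar (hD : D < 0) {σ : Gal(QBar/ℚ)}
    (hσ : σ (sqrtQBar hD) = sqrtQBar hD) (x : ImagQuad D) :
    σ (imagQuadToQBar hD x) = imagQuadToQBar hD x := by
  have h : ((σ : QBar →ₐ[ℚ] QBar).comp (imagQuadToQBar hD)) = imagQuadToQBar hD := by
    refine IntermediateField.algHom_ext_of_eq_adjoin _ rfl ?_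
    intro y hy
    obtain rfl := hy
    exact hσ
  exact DFunLike.congr_fun h x

open Polynomial in
theorem rootMultiplicity_gal (hD : D < 0) {σ : Gal(QBar/ℚ)}
    (hσ : σ (sqrtQBar hD) = sqrtQBar hD) (P : (ImagQuad D)[X]) (x : QBar) :
    (P.map (algebraMap (ImagQuad D) ℂ)).rootMultiplicity ((σ x : QBar) : ℂ) =
      (P.map (algebraMap (ImagQuad D) ℂ)).rootMultiplicity (x : ℂ) := by
  have h1 : P.map (algebraMap (ImagQuad D) ℂ) =
      (P.map (imagQuadToQBar hD : ImagQuad D →+* QBar)).map (algebraMap QBar ℂ) := by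
    rw [Polynomial.map_map]
    rfl
  have h2 : (P.map (imagQuadToQBar hD : ImagQuad D →+* QBar)).map (σ : QBar →+* QBar) =
      P.map (imagQuadToQBar hD : ImagQuad D →+* QBar) := by
    rw [Polynomial.map_map]
    congr 1
    ext y
    exact congrArg Subtype.val (gal_imagQuadToQBar hD hσ y)
  rw [h1]
  have h3 : ∀ y : QBar, (P.map (imagQuadToQBar hD : ImagQuad D →+* QBar)).rootMultiplicity y =
      ((P.map (imagQuadToQBar hD : ImagQuad D →+* QBar)).map
        (algebraMap QBar ℂ)).rootMultiplicity (y : ℂ) := fun y =>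
    Polynomial.eq_rootMultiplicity_map (algebraMap QBar ℂ).injective y
  rw [← h3, ← h3]
  conv_lhs => rw [← h2]
  exact (Polynomial.eq_rootMultiplicity_map (f := (σ : QBar →+* QBar)) σ.injective x).symm

theorem pow_val_intCast_mul {N : ℕ} [NeZero N] {ξ : ℂ} (hξ : ξ ^ N = 1) (u : ℤ) (b : ZMod N) :
    ξ ^ ((u : ZMod N) * b).val = (ξ ^ b.val) ^ u := by
  have h0 : ξ ≠ 0 := by
    rintro rfl
    rw [zero_pow (NeZero.ne N)] at hξ
    exact zero_ne_one hξ
  have h1 : (u : ZMod N) * b = ((u * b.val : ℤ) : ZMod N) := by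
    push_cast
    rw [ZMod.natCast_zmod_val]
  rw [← zpow_natCast, ← zpow_natCast, ← zpow_mul, h1, ZMod.val_intCast]
  have h2 := Int.emod_add_mul_ediv (u * b.val) N
  conv_rhs => rw [mul_comm, ← h2, zpow_add₀ h0, zpow_mul, zpow_natCast, hξ, one_zpow, mul_one]

theorem mulInvariant_rootMultiplicity (hD : D < 0) (P : Polynomial (ImagQuad D)) {N : ℕ} [NeZero N]
    {ξ : ℂ} (hξ : ξ ^ N = 1) {d : ℕ} (hd : 0 < d) {u : ℤ} {σ : Gal(QBar/ℚ)}
    (hσ : σ (sqrtQBar hD) = sqrtQBar hD) (hu : ∀ x : QBar, x ^ d = 1 → σ x = x ^ u) :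
    MulInvariant (fun b : ZMod N =>
      (P.map (algebraMap (ImagQuad D) ℂ)).rootMultiplicity (ξ ^ b.val)) d u := by
  intro b hb
  have h1 : (ξ ^ b.val) ^ d = 1 := by
    have h2 := pow_val_intCast_mul hξ d b
    rw [Int.cast_natCast, hb, ZMod.val_zero, pow_zero, zpow_natCast] at h2
    exact h2.symm
  have h3 := rootMultiplicity_gal hD hσ P ⟨ξ ^ b.val, rootOfUnity_mem_qBar hd h1⟩
  rw [hu _ (Subtype.ext (by simpa using h1))] at h3
  change (P.map (algebraMap (ImagQuad D) ℂ)).rootMultiplicity (ξ ^ ((u : ZMod N) * b).val) = _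
  rw [pow_val_intCast_mul hξ]
  refine Eq.trans ?_ h3
  congr 1

/-- The multiplicities of roots of unity as roots of a polynomial over `ℚ(√D)`. -/
theorem isQuadraticInvariant_rootMultiplicity (hsq : Squarefree D) (hD : D < -3)
    (P : Polynomial (ImagQuad D)) {N : ℕ} [NeZero N] {ξ : ℂ} (hξ : ξ ^ N = 1) :
    IsQuadraticInvariant fun b : ZMod N =>
      (P.map (algebraMap (ImagQuad D) ℂ)).rootMultiplicity (ξ ^ b.val) := by
  have hD0 : D < 0 := by omega
  refine ⟨fun d u hd hu => ?_, ?_, ?_⟩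
  · obtain ⟨σ, hσ, h | h⟩ := exists_gal_pow_or_neg hD0 hd hu
    · exact Or.inl (mulInvariant_rootMultiplicity hD0 P hξ hd hσ h)
    · exact Or.inr (mulInvariant_rootMultiplicity hD0 P hξ hd hσ h)
  · obtain ⟨σ, hσ, h⟩ := exists_gal_inv_eight hsq hD hD0
    exact mulInvariant_rootMultiplicity hD0 P hξ (by norm_num) hσ h
  · obtain ⟨σ, hσ, h⟩ := exists_gal_inv_twelve hsq hD hD0
    exact mulInvariant_rootMultiplicity hD0 P hξ (by norm_num) hσ h

end Galois

/-! ### Forms of signature `(n, 1)` and isometries stabilising a negative line. -/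

section Hermitian

variable {E : Type*} [AddCommGroup E] [Module ℂ E] {B : E →ₗ⋆[ℂ] E →ₗ[ℂ] ℂ}

theorem HasSignature.re_pos_of_repr_eq_zero {p q : ℕ} (b : Module.Basis (Fin p ⊕ Fin q) ℂ E)
    (hb : ∀ i j, i ≠ j → B (b i) (b j) = 0)
    (hb1 : ∀ i, B (b (Sum.inl i)) (b (Sum.inl i)) = 1) {x : E}
    (hx : ∀ j, b.repr x (Sum.inr j) = 0) (hx0 : x ≠ 0) : 0 < (B x x).re := by
  have h1 : x = ∑ i : Fin p, b.repr x (Sum.inl i) • b (Sum.inl i) := by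
    conv_lhs => rw [← b.sum_repr x, Fintype.sum_sum_type]
    simp [hx]
  have h2 : B x x = ((∑ i : Fin p, Complex.normSq (b.repr x (Sum.inl i)) : ℝ) : ℂ) := by
    conv_lhs => rw [h1]
    simp only [map_sum, LinearMap.sum_apply, map_smul, LinearMap.map_smulₛₗ, LinearMap.smul_apply,
      smul_eq_mul]
    push_cast
    refine Finset.sum_congr rfl fun i _ => ?_
    rw [Finset.sum_eq_single i]
    · rw [hb1, mul_one, Complex.normSq_eq_conj_mul_self, mul_comm]
    · intro j _ hji
      rw [hb _ _ (by simpa using hji)]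
      simp
    · simp
  rw [h2, Complex.ofReal_re]
  refine lt_of_le_of_ne (Finset.sum_nonneg fun i _ => Complex.normSq_nonneg _) fun h0 => hx0 ?_
  have h3 := (Finset.sum_eq_zero_iff_of_nonneg fun i _ => Complex.normSq_nonneg _).1 h0.symm
  rw [h1]
  refine Finset.sum_eq_zero fun i hi => ?_
  rw [Complex.normSq_eq_zero.1 (h3 i hi), zero_smul]

theorem HasSignature.re_pos_of_orthogonal {n : ℕ} (hsig : HasSignature B n 1)
    (hB : ∀ x y, conj (B x y) = B y x) {ω : E} (hω : (B ω ω).re < 0) {u : E} (hu : B ω u = 0)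
    (hu0 : u ≠ 0) : 0 < (B u u).re := by
  obtain ⟨b, hb, hb1, -⟩ := hsig
  by_contra! hneg
  have hω0 : ω ≠ 0 := by rintro rfl; simp at hω
  have huω : B u ω = 0 := by rw [← hB, hu, map_zero]
  let f : E →ₗ[ℂ] ℂ := b.coord (Sum.inr 0)
  have hpos : ∀ x, f x = 0 → x ≠ 0 → 0 < (B x x).re := fun x hx hx0 =>
    HasSignature.re_pos_of_repr_eq_zero b hb hb1
      (fun j => by rw [Subsingleton.elim j 0]; exact hx) hx0
  have hfu : f u ≠ 0 := fun h => absurd (hpos u h hu0) (not_lt.2 hneg)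
  -- This combination has no component along the negative basis vector, so its square is positive;
  -- but it is also a combination of two orthogonal vectors of nonpositive square.
  have hx0 : f ω • u - f u • ω ≠ 0 := by
    intro h
    have h1 := congrArg (B ω) h
    simp only [map_sub, map_smul, hu, map_zero, smul_eq_mul, mul_zero, zero_sub, neg_eq_zero,
      mul_eq_zero] at h1
    rcases h1 with h1 | h1
    · exact hfu h1
    · rw [h1] at hω; simp at hω
  have h1 := hpos (f ω • u - f u • ω) (by simp [mul_comm]) hx0
  have h2 : B (f ω • u - f u • ω) (f ω • u - f u • ω) =
      (Complex.normSq (f ω) : ℂ) * B u u + (Complex.normSq (f u) : ℂ) * B ω ω := by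
    simp only [map_sub, map_smul, LinearMap.map_smulₛₗ, LinearMap.smul_apply, LinearMap.sub_apply,
      smul_eq_mul, hu, huω, Complex.normSq_eq_conj_mul_self]
    ring
  rw [h2, Complex.add_re, Complex.re_ofReal_mul, Complex.re_ofReal_mul] at h1
  have h3 := mul_nonneg (Complex.normSq_nonneg (f ω)) (neg_nonneg.2 hneg)
  have h4 := mul_nonneg (Complex.normSq_nonneg (f u)) (neg_nonneg.2 hω.le)
  linarith

theorem exists_norm_bound_of_core [FiniteDimensional ℂ E] (c : InnerProductSpace.Core ℂ E)
    (ℓ : E →ₗ[ℂ] ℂ) : ∃ C : ℝ, ∀ x, ‖ℓ x‖ ≤ C * Real.sqrt (c.inner x x).re := by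
  let _ : NormedAddCommGroup E := c.toNormedAddCommGroup
  let _ : InnerProductSpace ℂ E := InnerProductSpace.ofCore c.toCore
  exact ⟨‖LinearMap.toContinuousLinearMap ℓ‖, fun x =>
    (LinearMap.toContinuousLinearMap ℓ).le_opNorm x⟩

/-- The positive definite form obtained from a form of signature `(n, 1)` by changing its sign on
a negative line. -/
@[reducible]
noncomputable def signChangeCore {n : ℕ} (hsig : HasSignature B n 1)
    (hB : ∀ x y, conj (B x y) = B y x) {ω : E} (hω : (B ω ω).re < 0) :
    InnerProductSpace.Core ℂ E :=
  have key : ∀ x, ∃ (u : E) (t : ℂ), B ω u = 0 ∧ x = u + t • ω ∧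
      (B x x + ((2 / -(B ω ω).re : ℝ) : ℂ) * (conj (B ω x) * B ω x)).re =
        (B u u).re + Complex.normSq t * -(B ω ω).re := by
    intro x
    have hreal : B ω ω = ((B ω ω).re : ℂ) := (Complex.conj_eq_iff_re.1 (hB ω ω)).symm
    have hne : (B ω ω).re ≠ 0 := hω.ne
    generalize (B ω ω).re = r at hreal hne ⊢
    have hneC : (r : ℂ) ≠ 0 := by exact_mod_cast hne
    have hu : B ω (x - (B ω x / r) • ω) = 0 := by
      rw [map_sub, map_smul, smul_eq_mul, hreal, div_mul_cancel₀ _ hneC, sub_self]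
    refine ⟨x - (B ω x / r) • ω, B ω x / r, hu, by abel, ?_⟩
    generalize hv : x - (B ω x / r) • ω = v at hu ⊢
    generalize ht : B ω x / r = t at hv ⊢
    have hx : x = v + t • ω := by rw [← hv]; abel
    have hvω : B v ω = 0 := by rw [← hB, hu, map_zero]
    have h1 : B ω x = t * r := by rw [← ht, div_mul_cancel₀ _ hneC]
    have h2 : B x x = B v v + (Complex.normSq t : ℂ) * r := by
      rw [hx]
      simp only [map_add, map_smul, LinearMap.map_smulₛₗ, LinearMap.smul_apply,
        LinearMap.add_apply, smul_eq_mul, hu, hvω, hreal, Complex.normSq_eq_conj_mul_self]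
      ring
    have h3 : ((2 / -r : ℝ) : ℂ) * (conj (B ω x) * B ω x) =
        ((-2 * Complex.normSq t * r : ℝ) : ℂ) := by
      rw [h1, map_mul, Complex.conj_ofReal]
      push_cast
      rw [Complex.normSq_eq_conj_mul_self]
      field_simp
    rw [h2, h3, Complex.add_re, Complex.add_re, Complex.ofReal_re, Complex.re_ofReal_mul,
      Complex.ofReal_re]
    ring
  have nonneg : ∀ u, B ω u = 0 → 0 ≤ (B u u).re := by
    intro u hu
    rcases eq_or_ne u 0 with rfl | hu0
    · simp
    · exact (hsig.re_pos_of_orthogonal hB hω hu hu0).le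
  { inner := fun x y => B x y + ((2 / -(B ω ω).re : ℝ) : ℂ) * (conj (B ω x) * B ω y)
    conj_inner_symm := fun x y => by
      simp only [map_add, map_mul, Complex.conj_ofReal, hB]
      ring
    re_inner_nonneg := fun x => by
      obtain ⟨u, t, hu, -, h⟩ := key x
      change 0 ≤ (B x x + ((2 / -(B ω ω).re : ℝ) : ℂ) * (conj (B ω x) * B ω x)).re
      rw [h]
      exact add_nonneg (nonneg u hu) (mul_nonneg (Complex.normSq_nonneg t) (by linarith))
    add_left := fun x y z => by
      simp only [map_add, LinearMap.add_apply]
      ring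
    smul_left := fun x y r => by
      simp only [LinearMap.map_smulₛₗ, map_smul, LinearMap.smul_apply, smul_eq_mul, map_mul]
      ring
    definite := fun x hx => by
      obtain ⟨u, t, hu, hxu, h⟩ := key x
      have h0 := congrArg Complex.re hx
      rw [Complex.zero_re] at h0
      change (B x x + ((2 / -(B ω ω).re : ℝ) : ℂ) * (conj (B ω x) * B ω x)).re = 0 at h0
      rw [h] at h0
      have h1 := nonneg u hu
      have h2 : 0 ≤ Complex.normSq t * -(B ω ω).re :=
        mul_nonneg (Complex.normSq_nonneg t) (by linarith)
      have ht : t = 0 := by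
        have : Complex.normSq t * -(B ω ω).re = 0 := by linarith
        rcases mul_eq_zero.1 this with h | h
        · exact Complex.normSq_eq_zero.1 h
        · linarith
      have hu0 : u = 0 := by
        by_contra hne
        have := hsig.re_pos_of_orthogonal hB hω hu hne
        linarith
      rw [hxu, ht, hu0, zero_smul, add_zero] }

/-- Since `B ω ω ≠ 0`, the scalar by which `A` acts on `ω` has modulus 1, so `A` also preserves the
definite form `signChangeCore`. The bound `C` is uniform in `A`, which gives finiteness below. -/
theorem exists_norm_bound_of_isometry [FiniteDimensional ℂ E] {n : ℕ} (hsig : HasSignature B n 1)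
    (hB : ∀ x y, conj (B x y) = B y x) {ω : E} (hω : (B ω ω).re < 0) (ℓ : E →ₗ[ℂ] ℂ) (x : E) :
    ∃ C : ℝ, ∀ A : E →ₗ[ℂ] E, (∀ u v, B (A u) (A v) = B u v) → (∃ c : ℂ, A ω = c • ω) →
      ‖ℓ (A x)‖ ≤ C := by
  obtain ⟨C, hC⟩ := exists_norm_bound_of_core (signChangeCore hsig hB hω) ℓ
  refine ⟨C * Real.sqrt ((signChangeCore hsig hB hω).inner x x).re, fun A hA ⟨c, hc⟩ => ?_⟩
  have hωω : B ω ω ≠ 0 := by intro h; rw [h] at hω; simp at hω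
  have h1 : conj c * c = 1 := by
    have h := hA ω ω
    rw [hc, map_smul, LinearMap.map_smulₛₗ, LinearMap.smul_apply, smul_eq_mul, smul_eq_mul,
      ← mul_assoc] at h
    have := mul_right_cancel₀ hωω (h.trans (one_mul _).symm)
    rw [mul_comm]
    exact this
  have h2 : conj c * B ω (A x) = B ω x := by
    have h := hA ω x
    rwa [hc, LinearMap.map_smulₛₗ, LinearMap.smul_apply, smul_eq_mul] at h
  have h3 : (signChangeCore hsig hB hω).inner (A x) (A x) =
      (signChangeCore hsig hB hω).inner x x := by
    change B (A x) (A x) + _ * (conj (B ω (A x)) * B ω (A x)) = B x x + _ * (conj (B ω x) * B ω x)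
    rw [hA, ← h2, map_mul, Complex.conj_conj]
    linear_combination (-(((2 / -(B ω ω).re : ℝ) : ℂ) * (conj (B ω (A x)) * B ω (A x)))) * h1
  rw [← h3]
  exact hC (A x)

end Hermitian

/-! ### Finite order of the stabilising isometries. -/

section FiniteOrder

variable {D : ℤ}

/-- The only embeddings are the inclusion and its conjugate. So a bound on one absolute value bounds
all of them, and only finitely many integers of the field satisfy it. -/
theorem embedding_imagQuad (hD : D < 0) (φ : ImagQuad D →+* ℂ) (x : ImagQuad D) :
    ‖φ x‖ = ‖(x : ℂ)‖ := by
  let φ' : ImagQuad D →ₐ[ℚ] ℂ := φ.toRatAlgHom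
  let s : ImagQuad D := ⟨sqrtC D, IntermediateField.mem_adjoin_simple_self ℚ _⟩
  have hs : φ' s ^ 2 = sqrtC D ^ 2 := by
    have : s ^ 2 = (D : ImagQuad D) := by
      apply Subtype.ext
      push_cast
      exact sqrtC_sq hD
    rw [← map_pow, this, map_intCast, sqrtC_sq hD]
  rcases sq_eq_sq_iff_eq_or_eq_neg.1 hs with h | h
  · have : φ' = (ImagQuad D).val := by
      refine IntermediateField.algHom_ext_of_eq_adjoin _ rfl ?_
      intro y hy
      obtain rfl := hy
      exact h
    exact congrArg (fun f : ImagQuad D →ₐ[ℚ] ℂ => ‖f x‖) this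
  · have : φ' = ((Complex.conjAe.restrictScalars ℚ : ℂ ≃ₐ[ℚ] ℂ) : ℂ →ₐ[ℚ] ℂ).comp
        (ImagQuad D).val := by
      refine IntermediateField.algHom_ext_of_eq_adjoin _ rfl ?_
      intro y hy
      obtain rfl := hy
      exact h.trans (conj_sqrtC D).symm
    refine (congrArg (fun f : ImagQuad D →ₐ[ℚ] ℂ => ‖f x‖) this).trans ?_
    exact RCLike.norm_conj (x : ℂ)

theorem numberField_imagQuad (hD : D < 0) : NumberField (ImagQuad D) where
  to_charZero := inferInstance
  to_finiteDimensional :=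
    IntermediateField.adjoin.finiteDimensional (mem_algebraicClosure_iff'.1 (sqrtC_mem_qBar hD))

theorem finite_norm_le (hD : D < 0) (C : ℝ) :
    {a : 𝓞 (ImagQuad D) | ‖algebraMap (𝓞 (ImagQuad D)) ℂ a‖ ≤ C}.Finite := by
  have := numberField_imagQuad hD
  have h := Embeddings.finite_of_norm_le (ImagQuad D) ℂ C
  refine Set.Finite.of_finite_image (h.subset ?_) RingOfIntegers.coe_injective.injOn
  rintro _ ⟨a, ha, rfl⟩
  exact ⟨a.2, fun φ => by rw [embedding_imagQuad hD]; exact ha⟩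

variable {Λ : Type*} [AddCommGroup Λ] [Module (𝓞 (ImagQuad D)) Λ]

theorem conj_formC {h : SesqForm D Λ} (hherm : ∀ x y, conjInt D (h x y) = h y x)
    (u v : Complexification D Λ) : conj (formC h u v) = formC h v u := by
  induction u using TensorProduct.induction_on with
  | zero => simp
  | add u u' hu hu' => simp only [map_add, LinearMap.add_apply, hu, hu']
  | tmul a x =>
    induction v using TensorProduct.induction_on with
    | zero => simp
    | add v v' hv hv' => simp only [map_add, LinearMap.add_apply, hv, hv']
    | tmul b y =>
      rw [formC_tmul, formC_tmul, map_mul, map_mul, Complex.conj_conj, ← algebraMap_conjInt, hherm]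
      ring

theorem extendAut_tmul (g : Λ ≃ₗ[𝓞 (ImagQuad D)] Λ) (a : ℂ) (x : Λ) :
    extendAut g (a ⊗ₜ x) = a ⊗ₜ g x := rfl

theorem formC_extendAut {h : SesqForm D Λ} {g : Λ ≃ₗ[𝓞 (ImagQuad D)] Λ}
    (hg : ∀ x y, h (g x) (g y) = h x y) (u v : Complexification D Λ) :
    formC h (extendAut g u) (extendAut g v) = formC h u v := by
  induction u using TensorProduct.induction_on with
  | zero => simp
  | add u u' hu hu' => simp only [map_add, LinearMap.add_apply, hu, hu']
  | tmul a x =>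
    induction v using TensorProduct.induction_on with
    | zero => simp
    | add v v' hv hv' => simp only [map_add, hv, hv']
    | tmul b y => rw [extendAut_tmul, extendAut_tmul, formC_tmul, formC_tmul, hg]

/-- All powers of `g` stabilise the line, so their matrix entries in an `𝓞`-basis are uniformly
bounded elements of `𝓞`. Infinite order would give infinitely many distinct matrices in a finite
set. -/
theorem isOfFinOrder_of_stabilizes [Module.Free (𝓞 (ImagQuad D)) Λ]
    [Module.Finite (𝓞 (ImagQuad D)) Λ] (hD : D < 0) {n : ℕ} {h : SesqForm D Λ}
    (hherm : ∀ x y, conjInt D (h x y) = h y x) (hsig : HasSignature (formC h) n 1)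
    {ω : Complexification D Λ} (hω : (formC h ω ω).re < 0) (g : unitaryGroup h)
    (hg : ∃ c : ℂ, extendAut (g : Λ ≃ₗ[𝓞 (ImagQuad D)] Λ) ω = c • ω) : IsOfFinOrder g := by
  by_contra hinf
  rw [← injective_pow_iff_not_isOfFinOrder] at hinf
  let b := Module.Free.chooseBasis (𝓞 (ImagQuad D)) Λ
  let bC := b.baseChange ℂ
  choose C hC using fun i j => exists_norm_bound_of_isometry hsig (conj_formC hherm) hω
    (bC.coord i) ((1 : ℂ) ⊗ₜ[𝓞 (ImagQuad D)] b j)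
  have hpow : ∀ k : ℕ, ∃ c : ℂ,
      extendAut ((g ^ k : unitaryGroup h) : Λ ≃ₗ[𝓞 (ImagQuad D)] Λ) ω = c • ω := by
    obtain ⟨c, hc⟩ := hg
    intro k
    induction k with
    | zero => exact ⟨1, by simp⟩
    | succ k ih =>
      obtain ⟨c', hc'⟩ := ih
      refine ⟨c * c', ?_⟩
      rw [pow_succ, Subgroup.coe_mul, map_mul, LinearEquiv.mul_apply, hc, map_smul, hc', smul_smul]
  have hentry : ∀ (k : ℕ) i j,
      b.repr (((g ^ k : unitaryGroup h) : Λ ≃ₗ[𝓞 (ImagQuad D)] Λ) (b j)) i ∈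
        {a : 𝓞 (ImagQuad D) | ‖algebraMap (𝓞 (ImagQuad D)) ℂ a‖ ≤ C i j} := by
    intro k i j
    have h1 := hC i j (extendAut ((g ^ k : unitaryGroup h) : Λ ≃ₗ[𝓞 (ImagQuad D)] Λ) : _ →ₗ[ℂ] _)
      (formC_extendAut (g ^ k).2) (hpow k)
    rw [LinearEquiv.coe_coe, extendAut_tmul, Module.Basis.coord_apply,
      Module.Basis.baseChange_repr_tmul] at h1
    simpa [Algebra.smul_def] using h1
  have hfin : (Set.pi Set.univ fun i => Set.pi Set.univ fun j =>
      {a : 𝓞 (ImagQuad D) | ‖algebraMap (𝓞 (ImagQuad D)) ℂ a‖ ≤ C i j}).Finite :=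
    Set.Finite.pi fun i => Set.Finite.pi fun j => finite_norm_le hD _
  let F : ℕ → _ → _ → 𝓞 (ImagQuad D) := fun k i j =>
    b.repr (((g ^ k : unitaryGroup h) : Λ ≃ₗ[𝓞 (ImagQuad D)] Λ) (b j)) i
  have hFinj : Function.Injective F := by
    intro k k' hkk
    apply hinf
    apply Subtype.ext
    apply LinearEquiv.toLinearMap_injective
    refine b.ext fun j => b.repr.injective (Finsupp.ext fun i => ?_)
    exact congrFun (congrFun hkk i) j
  refine (Set.infinite_range_of_injective hFinj) (hfin.subset ?_)
  rintro _ ⟨k, rfl⟩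
  exact fun i _ j _ => hentry k i j

end FiniteOrder

/-! ### Eigenspaces of endomorphisms of finite order. -/

section Eigenspaces

variable {E : Type*} [AddCommGroup E] [Module ℂ E]

theorem finrank_eigenspace_eq_rootMultiplicity [FiniteDimensional ℂ E] {A : Module.End ℂ E} {N : ℕ}
    (hN : 0 < N) (hA : A ^ N = 1) (μ : ℂ) :
    Module.finrank ℂ (A.eigenspace μ) = A.charpoly.rootMultiplicity μ := by
  have hss : A.IsSemisimple := by
    refine Module.End.isSemisimple_of_squarefree_aeval_eq_zero
      (p := Polynomial.X ^ N - Polynomial.C 1) ?_ (by simp [hA])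
    exact ((Polynomial.separable_X_pow_sub_C (1 : ℂ) (by exact_mod_cast hN.ne')
      one_ne_zero)).squarefree
  rw [← LinearMap.finrank_maxGenEigenspace_eq, hss.isFinitelySemisimple.maxGenEigenspace_eq_eigenspace]

theorem pow_eq_one_of_eigenspace_ne_bot {A : Module.End ℂ E} {N : ℕ} (hA : A ^ N = 1) {μ : ℂ}
    (hμ : A.eigenspace μ ≠ ⊥) : μ ^ N = 1 := by
  obtain ⟨v, hv, hv0⟩ := Submodule.exists_mem_ne_zero_of_ne_bot hμ
  have h1 : (A ^ N) v = μ ^ N • v :=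
    Module.End.HasEigenvector.pow_apply ⟨hv, hv0⟩ N
  rw [hA, Module.End.one_apply] at h1
  have h2 : (μ ^ N - 1) • v = 0 := by rw [sub_smul, one_smul, ← h1, sub_self]
  rcases smul_eq_zero.1 h2 with h | h
  · exact sub_eq_zero.1 h
  · exact absurd h hv0

theorem pow_val_injective {N : ℕ} [NeZero N] {ξ : ℂ} (hξ : IsPrimitiveRoot ξ N) :
    Function.Injective fun b : ZMod N => ξ ^ b.val := fun b c h =>
  ZMod.val_injective N (hξ.pow_inj (ZMod.val_lt b) (ZMod.val_lt c) h)

theorem sum_finrank_eigenspace [FiniteDimensional ℂ E] {A : Module.End ℂ E} {N : ℕ} [NeZero N]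
    (hA : A ^ N = 1) {ξ : ℂ} (hξ : IsPrimitiveRoot ξ N) :
    ∑ b : ZMod N, Module.finrank ℂ (A.eigenspace (ξ ^ b.val)) = Module.finrank ℂ E := by
  classical
  have hN : 0 < N := Nat.pos_of_ne_zero (NeZero.ne N)
  simp only [finrank_eigenspace_eq_rootMultiplicity hN hA, ← Polynomial.count_roots]
  rw [← Finset.sum_image (f := fun x => A.charpoly.roots.count x) (pow_val_injective hξ).injOn,
    Multiset.sum_count_eq_card]
  · rw [← LinearMap.charpoly_natDegree A]
    exact (IsAlgClosed.splits _).natDegree_eq_card_roots.symm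
  · intro x hx
    have hx' : A.eigenspace x ≠ ⊥ := by
      intro hbot
      have h1 := finrank_eigenspace_eq_rootMultiplicity hN hA x
      rw [hbot, finrank_bot, ← Polynomial.count_roots] at h1
      exact absurd (Multiset.count_pos.2 hx) (by omega)
    obtain ⟨i, hi, rfl⟩ := hξ.eq_pow_of_pow_eq_one (pow_eq_one_of_eigenspace_ne_bot hA hx')
    exact Finset.mem_image.2 ⟨(i : ZMod N), Finset.mem_univ _, by
      simp only [ZMod.val_natCast, Nat.mod_eq_of_lt hi]⟩

theorem mem_eigenspace_of_mem_eigenspace_mapQ {A : Module.End ℂ E} {N : ℕ} (hN : 0 < N)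
    (hA : A ^ N = 1) {W : Submodule ℂ E} {ω : E} (hω0 : ω ≠ 0) (hW : W = ℂ ∙ ω) {α : ℂ}
    (hω : A ω = α • ω) (hAW : W ≤ W.comap A) {μ : ℂ} {v : E}
    (hv : W.mkQ v ∈ Module.End.eigenspace (W.mapQ W A hAW) μ) :
    ∃ v' ∈ A.eigenspace μ, W.mkQ v' = W.mkQ v := by
  rw [Module.End.mem_eigenspace_iff, Submodule.mkQ_apply, Submodule.mapQ_apply,
    ← Submodule.Quotient.mk_smul, Submodule.Quotient.eq, hW, Submodule.mem_span_singleton] at hv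
  obtain ⟨t, ht⟩ := hv
  have hAv : A v = μ • v + t • ω := by rw [ht]; abel
  rcases eq_or_ne μ α with rfl | hne
  -- A Jordan block at `μ = α` would make the coefficient of `ω` in `A ^ N v` equal to `N * μ ^ (N -
  -- 1) * t`, which must vanish.
  · have hpow : ∀ k : ℕ, (A ^ k) v = μ ^ k • v + (k * μ ^ (k - 1) * t) • ω := by
      intro k
      induction k with
      | zero => simp
      | succ k ih =>
        rw [pow_succ', Module.End.mul_apply, ih, map_add, map_smul, map_smul, hAv, hω]
        rcases k with _ | k
        · simp
        · simp only [Nat.add_sub_cancel]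
          push_cast
          module
    have hμN : μ ^ N = 1 := pow_eq_one_of_eigenspace_ne_bot hA (fun hbot => hω0 (by
      have : ω ∈ A.eigenspace μ := Module.End.mem_eigenspace_iff.2 hω
      rwa [hbot, Submodule.mem_bot] at this))
    have h1 := hpow N
    rw [hA, hμN, one_smul, Module.End.one_apply, left_eq_add, smul_eq_zero] at h1
    have hμ0 : μ ≠ 0 := by
      rintro rfl
      rw [zero_pow hN.ne'] at hμN
      exact zero_ne_one hμN
    have ht0 : t = 0 := by
      rcases h1 with h1 | h1
      · rcases mul_eq_zero.1 h1 with h1 | h1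
        · rcases mul_eq_zero.1 h1 with h1 | h1
          · exact absurd h1 (by exact_mod_cast hN.ne')
          · exact absurd h1 (pow_ne_zero _ hμ0)
        · exact h1
      · exact absurd h1 hω0
    exact ⟨v, Module.End.mem_eigenspace_iff.2 (by rw [hAv, ht0, zero_smul, add_zero]), rfl⟩
  · have hne' : α - μ ≠ 0 := sub_ne_zero.2 hne.symm
    refine ⟨v + (-t / (α - μ)) • ω, Module.End.mem_eigenspace_iff.2 ?_, ?_⟩
    · rw [map_add, map_smul, hAv, hω]
      have : t = -(-t / (α - μ)) * (α - μ) := by field_simp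
      generalize -t / (α - μ) = s at this ⊢
      rw [this]
      module
    · rw [map_add, add_eq_left, Submodule.mkQ_apply, Submodule.Quotient.mk_eq_zero, hW]
      exact Submodule.smul_mem _ _ (Submodule.mem_span_singleton_self ω)

theorem finrank_eigenspace_mapQ [FiniteDimensional ℂ E] {A : Module.End ℂ E} {N : ℕ} (hN : 0 < N)
    (hA : A ^ N = 1) {W : Submodule ℂ E} {ω : E} (hω0 : ω ≠ 0) (hW : W = ℂ ∙ ω) {α : ℂ}
    (hω : A ω = α • ω) (hAW : W ≤ W.comap A) (μ : ℂ) :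
    Module.finrank ℂ (Module.End.eigenspace (W.mapQ W A hAW) μ) + (if μ = α then 1 else 0) =
      Module.finrank ℂ (A.eigenspace μ) := by
  let f : A.eigenspace μ →ₗ[ℂ] E ⧸ W := W.mkQ ∘ₗ (A.eigenspace μ).subtype
  have hrange : LinearMap.range f = Module.End.eigenspace (W.mapQ W A hAW) μ := by
    ext x
    constructor
    · rintro ⟨v, rfl⟩
      rw [Module.End.mem_eigenspace_iff]
      change W.mapQ W A hAW (W.mkQ v) = μ • W.mkQ v
      rw [Submodule.mkQ_apply, Submodule.mapQ_apply, Module.End.mem_eigenspace_iff.1 v.2]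
      rfl
    · intro hx
      obtain ⟨v, rfl⟩ := W.mkQ_surjective x
      obtain ⟨v', hv', h⟩ := mem_eigenspace_of_mem_eigenspace_mapQ hN hA hω0 hW hω hAW hx
      exact ⟨⟨v', hv'⟩, h⟩
  have hker : Module.finrank ℂ (LinearMap.ker f) = if μ = α then 1 else 0 := by
    have hmem : ∀ v : A.eigenspace μ, v ∈ LinearMap.ker f ↔ (v : E) ∈ ℂ ∙ ω := by
      intro v
      rw [LinearMap.mem_ker, ← hW]
      exact Submodule.Quotient.mk_eq_zero W
    split_ifs with h
    · subst h
      have hωm : ω ∈ A.eigenspace μ := Module.End.mem_eigenspace_iff.2 hω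
      have : LinearMap.ker f = ℂ ∙ (⟨ω, hωm⟩ : A.eigenspace μ) := by
        ext v
        rw [hmem, Submodule.mem_span_singleton, Submodule.mem_span_singleton]
        exact exists_congr fun c => by rw [Subtype.ext_iff]; rfl
      rw [this]
      exact finrank_span_singleton fun h => hω0 (congrArg Subtype.val h)
    · have : LinearMap.ker f = ⊥ := by
        rw [Submodule.eq_bot_iff]
        intro v hv
        obtain ⟨c, hc⟩ := Submodule.mem_span_singleton.1 ((hmem v).1 hv)
        have h1 := Module.End.mem_eigenspace_iff.1 v.2
        rw [← hc, map_smul, hω, smul_smul, smul_smul, ← sub_eq_zero, ← sub_smul,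
          smul_eq_zero] at h1
        have hc0 : c = 0 := by
          rcases h1 with h1 | h1
          · have : c * (α - μ) = 0 := by linear_combination h1
            rcases mul_eq_zero.1 this with h2 | h2
            · exact h2
            · exact absurd (sub_eq_zero.1 h2).symm h
          · exact absurd h1 hω0
        exact Subtype.ext (by rw [← hc, hc0, zero_smul]; rfl)
      rw [this, finrank_bot]
  rw [← hrange, ← hker]
  exact LinearMap.finrank_range_add_finrank_ker f

/-- Units modulo `l` lift to units modulo `N`. This allows an arbitrary `ζ` of order `l`, the order
on `V`, to be treated inside the possibly larger group of `N`-th roots of unity. -/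
theorem exists_primitiveRoot_pow_eq {l N : ℕ} (hN : 0 < N) (hl : l ∣ N) {ζ : ℂ}
    (hζ : IsPrimitiveRoot ζ l) : ∃ ξ : ℂ, IsPrimitiveRoot ξ N ∧ ξ ^ (N / l) = ζ := by
  have hl0 : 0 < l := Nat.pos_of_dvd_of_pos hl hN
  have : NeZero N := ⟨hN.ne'⟩
  have : NeZero l := ⟨hl0.ne'⟩
  obtain ⟨ξ, h0⟩ : ∃ ξ : ℂ, IsPrimitiveRoot ξ N := ⟨_, Complex.isPrimitiveRoot_exp N hN.ne'⟩
  have h1 : IsPrimitiveRoot (ξ ^ (N / l)) l := h0.pow hN (Nat.div_mul_cancel hl).symm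
  obtain ⟨i, hi, hcop, rfl⟩ := h1.isPrimitiveRoot_iff.1 hζ
  obtain ⟨u, hu⟩ := ZMod.unitsMap_surjective hl (ZMod.unitOfCoprime i hcop)
  refine ⟨ξ ^ (u : ZMod N).val, h0.pow_of_coprime _ (ZMod.val_coe_unit_coprime u), ?_⟩
  rw [← pow_mul, mul_comm, pow_mul]
  have h2 : (((u : ZMod N).val : ℕ) : ZMod l) = (i : ZMod l) := by
    rw [← ZMod.coe_unitOfCoprime i hcop, ← hu, ZMod.unitsMap_val, ZMod.cast_eq_val]
  have h3 : (u : ZMod N).val ≡ i [MOD l] := (ZMod.natCast_eq_natCast_iff _ _ _).1 h2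
  have h4 : orderOf (ξ ^ (N / l)) = l := h1.eq_orderOf.symm
  rw [← pow_mod_orderOf _ (u : ZMod N).val, ← pow_mod_orderOf _ i, h4]
  exact congrArg _ h3

end Eigenspaces

/-! ### From the tangent representation to the arithmetic inequality. -/

section ReidTai

theorem reidTaiSum_eq {M : Type*} [AddCommGroup M] [Module ℂ M] {T : Module.End ℂ M} {N : ℕ}
    [NeZero N] (hl : orderOf T ∣ N) {ξ : ℂ} (hξ : IsPrimitiveRoot ξ N) :
    reidTaiSum T (ξ ^ (N / orderOf T)) =
      ∑ b : ZMod N, (Module.finrank ℂ (T.eigenspace (ξ ^ b.val)) : ℚ) * ((b.val : ℚ) / N) := by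
  have hN : 0 < N := Nat.pos_of_ne_zero (NeZero.ne N)
  have hl0 : 0 < orderOf T := Nat.pos_of_dvd_of_pos hl hN
  have hT : T ^ orderOf T = 1 := pow_orderOf_eq_one T
  unfold reidTaiSum
  set l := orderOf T
  obtain ⟨k, hk⟩ := hl
  have hNl : N / l = k := by rw [hk, Nat.mul_div_cancel_left _ hl0]
  have hk0 : 0 < k := Nat.pos_of_ne_zero fun h0 => hN.ne' (by rw [hk, h0, mul_zero])
  rw [hNl]
  have hval : ∀ a ∈ Finset.range l, ((k * a : ℕ) : ZMod N).val = k * a := by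
    intro a ha
    rw [ZMod.val_natCast, Nat.mod_eq_of_lt]
    rw [hk, mul_comm l]
    exact Nat.mul_lt_mul_of_pos_left (Finset.mem_range.1 ha) hk0
  refine Finset.sum_of_injOn (fun a : ℕ => ((k * a : ℕ) : ZMod N)) ?_ ?_ ?_ ?_
  · intro a ha a' ha' h
    have h1 := congrArg ZMod.val h
    simp only [hval a ha, hval a' ha'] at h1
    exact Nat.eq_of_mul_eq_mul_left hk0 h1
  · intro a _
    exact Finset.mem_coe.2 (Finset.mem_univ _)
  · intro b _ hb
    have : T.eigenspace (ξ ^ b.val) = ⊥ := by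
      by_contra hbot
      have h1 := pow_eq_one_of_eigenspace_ne_bot hT hbot
      rw [← pow_mul] at h1
      have h2 : k * l ∣ b.val * l :=
        (dvd_of_eq (by rw [hk, mul_comm])).trans (hξ.dvd_of_pow_eq_one _ h1)
      obtain ⟨a, ha⟩ := Nat.dvd_of_mul_dvd_mul_right hl0 h2
      refine hb ⟨a, ?_, ?_⟩
      · have h3 : k * a < k * l := by
          rw [← ha, mul_comm k, ← hk]
          exact ZMod.val_lt b
        exact Finset.mem_coe.2 (Finset.mem_range.2 (Nat.lt_of_mul_lt_mul_left h3))
      · simp only [← ha, ZMod.natCast_zmod_val]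
    rw [this, finrank_bot]
    simp
  · intro a ha
    rw [hval a ha, pow_mul]
    congr 1
    have h1 : (k : ℚ) ≠ 0 := by exact_mod_cast hk0.ne'
    have h2 : (l : ℚ) ≠ 0 := by exact_mod_cast hl0.ne'
    rw [hk]
    push_cast
    field_simp

variable {D : ℤ} {Λ : Type*} [AddCommGroup Λ] [Module (𝓞 (ImagQuad D)) Λ]

theorem charpoly_extendAut [Module.Free (𝓞 (ImagQuad D)) Λ] [Module.Finite (𝓞 (ImagQuad D)) Λ]
    (g : Λ ≃ₗ[𝓞 (ImagQuad D)] Λ) :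
    LinearMap.charpoly (extendAut g : Complexification D Λ →ₗ[ℂ] Complexification D Λ) =
      (((g : Λ →ₗ[𝓞 (ImagQuad D)] Λ).charpoly.map
        (algebraMap (𝓞 (ImagQuad D)) (ImagQuad D)))).map (algebraMap (ImagQuad D) ℂ) := by
  rw [Polynomial.map_map]
  exact LinearMap.charpoly_baseChange (A := ℂ) (g : Λ →ₗ[𝓞 (ImagQuad D)] Λ)

/-- Evaluation at `ω` identifies `V` with `Λ_ℂ / 𝕎`, and the factor `g⁻¹` on `𝕎` divides the
eigenvalues by `α`. -/
theorem finrank_tangent_eigenspace [Module.Finite (𝓞 (ImagQuad D)) Λ] {h : SesqForm D Λ}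
    {Γ : Subgroup (unitaryGroup h)}
    {p : ℙ ℂ (Complexification D Λ)} (g : pointStabilizer h Γ p) {ω : Complexification D Λ}
    (hω0 : ω ≠ 0) (hp : p.submodule = ℂ ∙ ω) {α : ℂ} (hα : stabAct h Γ p g ω = α • ω) (μ : ℂ) :
    Module.finrank ℂ (Module.End.eigenspace (tangentRep h Γ p g) μ) =
      Module.finrank ℂ (Module.End.eigenspace (quotAct h Γ p g) (μ * α)) := by
  have hα0 : α ≠ 0 := by
    rintro rfl
    rw [zero_smul] at hα
    exact hω0 ((stabAct h Γ p g).map_eq_zero_iff.1 hα)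
  have hωp : ω ∈ p.submodule := by rw [hp]; exact Submodule.mem_span_singleton_self ω
  let ω' : p.submodule := ⟨ω, hωp⟩
  have hspan : ∀ u : p.submodule, ∃ c : ℂ, u = c • ω' := by
    intro u
    obtain ⟨c, hc⟩ := Submodule.mem_span_singleton.1 (hp.le u.2)
    exact ⟨c, Subtype.ext hc.symm⟩
  have hinv : lineAct h Γ p g⁻¹ ω' = α⁻¹ • ω' := by
    apply Subtype.ext
    change stabAct h Γ p g⁻¹ ω = α⁻¹ • ω
    have h1 : stabAct h Γ p g⁻¹ (stabAct h Γ p g ω) = ω := by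
      rw [← LinearEquiv.mul_apply, ← map_mul, inv_mul_cancel, map_one]
      rfl
    rw [hα, map_smul] at h1
    rw [← h1, smul_smul, inv_mul_cancel₀ hα0, one_smul, h1]
  let e : TangentSpaceAt p →ₗ[ℂ] (Complexification D Λ ⧸ p.submodule) :=
    LinearMap.applyₗ ω'
  have he : ∀ f, e f = f ω' := fun f => rfl
  have hinj : Function.Injective e := by
    intro f f' hff
    refine LinearMap.ext fun u => ?_
    obtain ⟨c, rfl⟩ := hspan u
    rw [map_smul, map_smul]
    exact congrArg _ hff
  have hfr : Module.finrank ℂ p.submodule = 1 := by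
    rw [hp]
    exact finrank_span_singleton hω0
  have hsurj : Function.Surjective e := by
    refine (LinearMap.injective_iff_surjective_of_finrank_eq_finrank ?_).1 hinj
    rw [Module.finrank_linearMap, hfr, one_mul]
  have hmap : (Module.End.eigenspace (tangentRep h Γ p g) μ).map e =
      Module.End.eigenspace (quotAct h Γ p g) (μ * α) := by
    have key : ∀ f, f ∈ Module.End.eigenspace (tangentRep h Γ p g) μ ↔
        e f ∈ Module.End.eigenspace (quotAct h Γ p g) (μ * α) := by
      intro f
      rw [Module.End.mem_eigenspace_iff, Module.End.mem_eigenspace_iff, ← hinj.eq_iff]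
      have h1 : e (tangentRep h Γ p g f) = α⁻¹ • quotAct h Γ p g (e f) := by
        change quotAct h Γ p g (f (lineAct h Γ p g⁻¹ ω')) = _
        rw [hinv, map_smul, map_smul]
        rfl
      rw [h1, map_smul, inv_smul_eq_iff₀ hα0, smul_smul, mul_comm α]
    ext x
    constructor
    · rintro ⟨f, hf, rfl⟩
      exact (key f).1 hf
    · intro hx
      obtain ⟨f, rfl⟩ := hsurj x
      exact ⟨f, (key f).2 hx, rfl⟩
  rw [← hmap]
  exact (Submodule.equivMapOfInjective e hinj _).finrank_eq

theorem finrank_tangentSpaceAt [Module.Free (𝓞 (ImagQuad D)) Λ]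
    [Module.Finite (𝓞 (ImagQuad D)) Λ] {n : ℕ}
    (hrank : Module.finrank (𝓞 (ImagQuad D)) Λ = n + 1) (p : ℙ ℂ (Complexification D Λ)) :
    Module.finrank ℂ (TangentSpaceAt p) = n := by
  have hfr : Module.finrank ℂ p.submodule = 1 := p.finrank_submodule
  have h1 := p.submodule.finrank_quotient_add_finrank
  rw [Module.finrank_linearMap, hfr, one_mul]
  rw [hfr, Module.finrank_baseChange, hrank] at h1
  omega

theorem one_le_reidTaiSum (hsq : Squarefree D) (hD : D < -3) {n : ℕ} (hn : 11 ≤ n)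
    [Module.Free (𝓞 (ImagQuad D)) Λ] [Module.Finite (𝓞 (ImagQuad D)) Λ]
    (hrank : Module.finrank (𝓞 (ImagQuad D)) Λ = n + 1) {h : SesqForm D Λ}
    {Γ : Subgroup (unitaryGroup h)} {p : ℙ ℂ (Complexification D Λ)} (g : pointStabilizer h Γ p)
    (hg : IsOfFinOrder g) (htriv : tangentRep h Γ p g ≠ 1)
    (hqr : ¬ IsQuasiReflection (tangentRep h Γ p g)) {ζ : ℂ}
    (hζ : IsPrimitiveRoot ζ (orderOf (tangentRep h Γ p g))) :
    1 ≤ reidTaiSum (tangentRep h Γ p g) ζ := by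
  obtain ⟨N, hN, hgN⟩ := isOfFinOrder_iff_pow_eq_one.1 hg
  have : NeZero N := ⟨hN.ne'⟩
  set T : Module.End ℂ (TangentSpaceAt p) := tangentRep h Γ p g with hT
  have hTN : T ^ N = 1 := by rw [hT, ← map_pow, hgN, map_one]
  have hl : orderOf T ∣ N := orderOf_dvd_of_pow_eq_one hTN
  obtain ⟨ξ, hξ, rfl⟩ := exists_primitiveRoot_pow_eq hN hl hζ
  let A : Module.End ℂ (Complexification D Λ) := (stabAct h Γ p g : _ →ₗ[ℂ] _)
  have hA : A ^ N = 1 := by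
    have h1 : stabAct h Γ p g ^ N = 1 := by rw [← map_pow, hgN, map_one]
    refine LinearMap.ext fun u => ?_
    have h2 : ∀ k : ℕ, (A ^ k) u = (stabAct h Γ p g ^ k) u := by
      intro k
      induction k with
      | zero => rfl
      | succ k ih => rw [pow_succ', pow_succ', Module.End.mul_apply, ih]; rfl
    rw [h2, h1]
    rfl
  let ω := p.rep
  have hω0 : ω ≠ 0 := p.rep_nonzero
  have hp : p.submodule = ℂ ∙ ω := p.submodule_eq
  have hAp : p.submodule ≤ p.submodule.comap A := stabAct_mem h Γ p g
  obtain ⟨α, hα⟩ : ∃ α : ℂ, A ω = α • ω := by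
    have h1 : A ω ∈ p.submodule := hAp (by rw [hp]; exact Submodule.mem_span_singleton_self ω)
    rw [hp, Submodule.mem_span_singleton] at h1
    obtain ⟨c, hc⟩ := h1
    exact ⟨c, hc.symm⟩
  have hαbot : A.eigenspace α ≠ ⊥ := by
    intro hbot
    have : ω ∈ A.eigenspace α := Module.End.mem_eigenspace_iff.2 hα
    rw [hbot, Submodule.mem_bot] at this
    exact hω0 this
  obtain ⟨i, hi, hiα⟩ := hξ.eq_pow_of_pow_eq_one (pow_eq_one_of_eigenspace_ne_bot hA hαbot)
  let j : ZMod N := (i : ZMod N)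
  have hj : ξ ^ j.val = α := by rw [ZMod.val_natCast, Nat.mod_eq_of_lt hi, hiα]
  let w : ZMod N → ℕ := fun b => Module.finrank ℂ (A.eigenspace (ξ ^ b.val))
  have hw : IsQuadraticInvariant w := by
    have h1 := isQuadraticInvariant_rootMultiplicity hsq hD
      (((((g : unitaryGroup h) : Λ ≃ₗ[𝓞 (ImagQuad D)] Λ) : Λ →ₗ[𝓞 (ImagQuad D)] Λ).charpoly).map
        (algebraMap (𝓞 (ImagQuad D)) (ImagQuad D))) hξ.pow_eq_one
    rw [← charpoly_extendAut] at h1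
    convert! h1 using 1
    funext b
    exact finrank_eigenspace_eq_rootMultiplicity hN hA _
  have hsum : ∑ b, w b = n + 1 := by
    rw [sum_finrank_eigenspace hA hξ, Module.finrank_baseChange, hrank]
  -- The extra 1 at `b = 0` is the line `𝕎` itself; it is harmless in the final sum because `b.val =
  -- 0` there.
  have hTA : ∀ b : ZMod N, Module.finrank ℂ (T.eigenspace (ξ ^ b.val)) +
      (if b = 0 then 1 else 0) = w (b + j) := by
    intro b
    have h1 : ξ ^ (b + j).val = ξ ^ b.val * α := by
      rw [← hj, ← pow_add, ZMod.val_add]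
      conv_rhs => rw [← Nat.mod_add_div (b.val + j.val) N, pow_add, pow_mul, hξ.pow_eq_one,
        one_pow, mul_one]
    have h2 := finrank_eigenspace_mapQ hN hA hω0 hp hα hAp (ξ ^ (b + j).val)
    have h3 : ξ ^ (b + j).val = α ↔ b = 0 := by
      rw [← hj, (pow_val_injective hξ).eq_iff, add_eq_right]
    simp only [h3] at h2
    change _ = Module.finrank ℂ (A.eigenspace (ξ ^ (b + j).val))
    rw [← h2, finrank_tangent_eigenspace g hω0 hp hα, h1]
    rfl
  have hV : Module.finrank ℂ (TangentSpaceAt p) = n := finrank_tangentSpaceAt hrank p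
  have hT1 := hTA 0
  rw [if_pos rfl, ZMod.val_zero, pow_zero, zero_add] at hT1
  have hle : Module.finrank ℂ (T.eigenspace 1) ≤ n := hV ▸ Submodule.finrank_le _
  have hne : Module.finrank ℂ (T.eigenspace 1) ≠ n := by
    intro heq
    have htop := Submodule.eq_top_of_finrank_eq (heq.trans hV.symm)
    apply htriv
    refine LinearMap.ext fun f => ?_
    have hf : f ∈ T.eigenspace 1 := htop ▸ Submodule.mem_top
    rw [Module.End.mem_eigenspace_iff, one_smul] at hf
    exact hf
  have hqr' : Module.finrank ℂ (T.eigenspace 1) + 1 ≠ n := fun heq => hqr (heq.trans hV.symm)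
  -- The fixed space on `V` has dimension `w j - 1`, and this is at most `n - 2`, whence `w j + 2 ≤
  -- n + 1`.
  have hmain := hw.le_sum (by omega) j (by omega) (by omega)
  rw [← Equiv.sum_comp (Equiv.addRight j)] at hmain
  simp only [Equiv.coe_addRight, add_sub_cancel_right, ← hTA] at hmain
  have hcast : (N : ℚ) ≤ ∑ b : ZMod N,
      (Module.finrank ℂ (T.eigenspace (ξ ^ b.val)) : ℚ) * (b.val : ℚ) := by
    have h1 : ∀ b : ZMod N, (((Module.finrank ℂ (T.eigenspace (ξ ^ b.val)) +
        (if b = 0 then 1 else 0) : ℕ) : ℤ) * (b.val : ℤ)) =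
        (Module.finrank ℂ (T.eigenspace (ξ ^ b.val)) : ℤ) * (b.val : ℤ) := by
      intro b
      split_ifs with hb
      · rw [hb, ZMod.val_zero]; simp
      · rw [add_zero]
    rw [Finset.sum_congr rfl fun b _ => h1 b] at hmain
    exact_mod_cast hmain
  rw [reidTaiSum_eq hl hξ]
  simp only [← mul_div_assoc]
  rw [← Finset.sum_div, one_le_div (by exact_mod_cast hN)]
  exact hcast

end ReidTai

end BallQuotient

theorem mainTheorem3 (D : ℤ) (hsq : Squarefree D) (hD : D < -3) (n : ℕ) (hn : 11 ≤ n)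
    {Λ : Type*} [AddCommGroup Λ] [Module (𝓞 (BallQuotient.ImagQuad D)) Λ]
    [Module.Free (𝓞 (BallQuotient.ImagQuad D)) Λ]
    [Module.Finite (𝓞 (BallQuotient.ImagQuad D)) Λ]
    (hrank : Module.finrank (𝓞 (BallQuotient.ImagQuad D)) Λ = n + 1)
    (h : BallQuotient.SesqForm D Λ) (hherm : ∀ x y, BallQuotient.conjInt D (h x y) = h y x)
    (hsig : BallQuotient.HasSignature (BallQuotient.formC h) n 1)
    (Γ : Subgroup (BallQuotient.unitaryGroup h)) (hΓ : Γ.FiniteIndex)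
    (p : ℙ ℂ (BallQuotient.Complexification D Λ))
    (hp : p ∈ BallQuotient.complexHyperbolicSpace h)
    (g : BallQuotient.pointStabilizer h Γ p)
    (htriv : BallQuotient.tangentRep h Γ p g ≠ 1)
    (hqr : ¬ BallQuotient.IsQuasiReflection (BallQuotient.tangentRep h Γ p g)) :
    IsOfFinOrder (BallQuotient.tangentRep h Γ p g) ∧
      ∀ ζ : ℂ, IsPrimitiveRoot ζ (orderOf (BallQuotient.tangentRep h Γ p g)) →
        1 ≤ BallQuotient.reidTaiSum (BallQuotient.tangentRep h Γ p g) ζ := by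
  have hg : IsOfFinOrder g := by
    rw [← Submonoid.isOfFinOrder_coe]
    refine BallQuotient.isOfFinOrder_of_stabilizes (by omega) hherm hsig hp _ ?_
    have h1 := BallQuotient.stabAct_mem h Γ p g p.rep
      (by rw [p.submodule_eq]; exact Submodule.mem_span_singleton_self _)
    rw [p.submodule_eq, Submodule.mem_span_singleton] at h1
    obtain ⟨c, hc⟩ := h1
    exact ⟨c, hc.symm⟩
  exact ⟨MonoidHom.isOfFinOrder _ hg,
    fun ζ hζ => BallQuotient.one_le_reidTaiSum hsq hD hn hrank g hg htriv hqr hζ⟩
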